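/- Let $\mathcal H$ be a complex Hilbert space and let $H_0\ge I$ be a self-adjoint operator on $\mathcal H$ with domain $\mathcal D(H_0)$, such that $\rho_0=Z_0^{-1}e^{-H_0}$, $Z_0=\operatorname{Tr}e^{-H_0}$, is a density operator with $\operatorname{Tr}\rho_0^{\beta_0}<\infty$ for some $0<\beta_0<1$. For a strictly positive self-adjoint operator $H$ with domain $\mathcal D(H)$, put $R=H^{-1}$ and let $\mathcal T_\omega(H)$ be the real vector space of symmetric operators $Y:\mathcal D(H)\to\mathcal H$ with $\|Y\|_{\omega}:=\|RY\|<\infty$ (the $\omega$-directions at $H$), normed by $\|\cdot\|_\omega$. Let $X\in\mathcal T_\omega(H_0)$ with $\|H_0^{-1}X\|<1-\beta_0$, and put $H_X=H_0+X$ on $\mathcal D(H_0)$. Then $H_X$ is self-adjoint with $H_X\ge mI$ for some $m>0$; the state $\rho_X=Z_X^{-1}e^{-H_X}$, $Z_X=\operatorname{Tr}e^{-H_X}$, is a density operator with $\operatorname{Tr}\rho_X^{p}<\infty$ for some $0<p<1$; and $\mathcal T_\omega(H_X)=\mathcal T_\omega(H_0)$ as vector spaces. For every $\omega$-direction $Y$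 (that is, $Y$ symmetric on $\mathcal D(H_X)$ with $\|R_XY\|<\infty$, $R_X=H_X^{-1}$) the operator $\rho_XY$ has a trace-class extension, whose trace is denoted $\rho_X.Y=\operatorname{Tr}(\rho_XY)$. Moreover, the free energy $\psi_X=\log Z_X$ is Fréchet differentiable in the $\omega$-topology: the map $Y\mapsto\psi_Y=\log\operatorname{Tr}e^{-(H_0+Y)}$ on the normed space $\mathcal T_\omega(H_0)$ is Fréchet differentiable at $X$, the map $Y\mapsto\psi_{X+Y}=\log\operatorname{Tr}e^{-(H_X+Y)}$ on the normed space $\mathcal T_\omega(H_X)$ is Fréchet differentiable at $0$, and in both cases the derivative in the direction $Y$ is $$\nabla_Y^+\psi_X=-\,\rho_X.Y=-\operatorname{Tr}(\rho_XY).$$ -/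

import Mathlib

open scoped InnerProductSpace

/-! ### Trace class, trace, and the classes `C_p` -/

section Trace

variable {E : Type*} [NormedAddCommGroup E] [InnerProductSpace ℂ E] [CompleteSpace E]

/-- A fixed orthonormal (Hilbert) basis of `E`, used to write traces as sums. -/
noncomputable def onBasis (E : Type*) [NormedAddCommGroup E] [InnerProductSpace ℂ E]
    [CompleteSpace E] :
    HilbertBasis (exists_hilbertBasis ℂ E).choose ℂ E :=
  (exists_hilbertBasis ℂ E).choose_spec.choose

/-- The sum `∑ ⟨e_i, |T| e_i⟩` of nonnegative terms converges. -/
def IsTraceClass (T : E →L[ℂ] E) : Prop :=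
  Summable fun i => (⟪onBasis E i, CFC.abs T (onBasis E i)⟫_ℂ).re

/-- `Tr T = ∑ ⟨e_i, T e_i⟩` (meaningful for trace-class `T`). -/
noncomputable def opTrace (T : E →L[ℂ] E) : ℂ :=
  ∑' i, ⟪onBasis E i, T (onBasis E i)⟫_ℂ

/-- The class `C_p`, `0 < p`: compact operators with `Tr |T|^p < ∞`. -/
def IsSchatten (p : ℝ) (T : E →L[ℂ] E) : Prop :=
  IsCompactOperator T ∧
    Summable fun i => (⟪onBasis E i, (CFC.abs T ^ p : E →L[ℂ] E) (onBasis E i)⟫_ℂ).re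

/-- Density operators: positive trace-class operators of trace one. -/
def IsDensityOperator (ρ : E →L[ℂ] E) : Prop :=
  0 ≤ ρ ∧ IsTraceClass ρ ∧ opTrace ρ = 1

/-- The underlying set `M = Σ ∩ ⋃_{0<p<1} C_p` of the quantum information manifold. -/
def stateManifold (E : Type*) [NormedAddCommGroup E] [InnerProductSpace ℂ E] [CompleteSpace E] :
    Set (E →L[ℂ] E) :=
  {ρ | IsDensityOperator ρ ∧ ∃ p : ℝ, 0 < p ∧ p < 1 ∧ IsSchatten p ρ}

end Trace

/-! ### Inverse, exponential and Gibbs state of a strictly positive self-adjoint operator -/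

section Operators

variable {E : Type*} [NormedAddCommGroup E] [InnerProductSpace ℂ E] [CompleteSpace E]

/-- `A ≥ m` in the sense of quadratic forms: `m ‖φ‖² ≤ ⟨φ, A φ⟩` for `φ` in the domain of `A`. -/
def IsBoundedBelowBy (A : E →ₗ.[ℂ] E) (m : ℝ) : Prop :=
  ∀ φ : A.domain, m * ‖(φ : E)‖ ^ 2 ≤ (⟪(φ : E), A φ⟫_ℂ).re

/-- `R` is an everywhere defined bounded two-sided inverse of the operator `A`. -/
def IsBoundedInverse (A : E →ₗ.[ℂ] E) (R : E →L[ℂ] E) : Prop :=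
  (∀ φ : A.domain, R (A φ) = φ) ∧ ∀ ψ : E, ∃ h : R ψ ∈ A.domain, A ⟨R ψ, h⟩ = ψ

open scoped Classical in
/-- `R = A⁻¹` as a bounded operator (with value `0` if `A` has no bounded inverse). -/
noncomputable def invOp (A : E →ₗ.[ℂ] E) : E →L[ℂ] E :=
  if h : ∃ R : E →L[ℂ] E, IsBoundedInverse A R then Classical.choose h else 0

/-- A self-adjoint operator `A ≥ m > 0` has a bounded inverse, so `invOp A` is its inverse. -/
theorem invOp_isBoundedInverse (A : E →ₗ.[ℂ] E) (hA : IsSelfAdjoint A) (m : ℝ) (hm : 0 < m)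
    (hge : IsBoundedBelowBy A m) : IsBoundedInverse A (invOp A) := by
  have hdense : Dense (A.domain : Set E) := hA.dense_domain
  have hlow : ∀ φ : A.domain, m * ‖(φ : E)‖ ≤ ‖A φ‖ := by
    intro φ
    rcases eq_or_ne (φ : E) 0 with h0 | h0
    · rw [h0]; simp
    · have h1 := hge φ
      have h2 : (⟪(φ : E), A φ⟫_ℂ).re ≤ ‖(φ : E)‖ * ‖A φ‖ :=
        (Complex.re_le_norm _).trans (norm_inner_le_norm _ _)
      have h3 : 0 < ‖(φ : E)‖ := norm_pos_iff.mpr h0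
      nlinarith
  have hsym : ∀ x y : A.domain, ⟪A x, (y : E)⟫_ℂ = ⟪(x : E), A y⟫_ℂ := by
    have h := LinearPMap.adjoint_isFormalAdjoint hdense
    rw [LinearPMap.isSelfAdjoint_def.mp hA] at h
    exact h
  have hinj : Function.Injective A.toFun := by
    rw [← LinearMap.ker_eq_bot, LinearMap.ker_eq_bot']
    intro φ hφ
    have h1 := hlow φ
    have h2 : A φ = 0 := hφ
    rw [h2, norm_zero] at h1
    have h3 : ‖(φ : E)‖ = 0 := by nlinarith [norm_nonneg (φ : E)]
    exact Subtype.ext (norm_eq_zero.mp h3)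
  -- the range is closed
  have hclosed : IsClosed (LinearMap.range A.toFun : Set E) := by
    rw [← isSeqClosed_iff_isClosed]
    intro u y hu hy
    choose v hv using fun n => LinearMap.mem_range.mp (hu n)
    have hv' : ∀ n, A (v n) = u n := hv
    have hcau : CauchySeq fun n => (v n : E) := by
      rw [Metric.cauchySeq_iff']
      intro ε hε
      obtain ⟨N, hN⟩ := Metric.cauchySeq_iff'.mp hy.cauchySeq (m * ε) (by positivity)
      refine ⟨N, fun n hn => ?_⟩
      have h1 := hN n hn
      have h2 := hlow (v n - v N)
      rw [LinearPMap.map_sub, hv', hv', ← dist_eq_norm] at h2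
      rw [dist_eq_norm]
      have h3 : m * ‖(v n : E) - v N‖ < m * ε := by
        refine lt_of_le_of_lt ?_ h1
        simpa using h2
      exact lt_of_mul_lt_mul_left h3 hm.le
    obtain ⟨x, hx⟩ := cauchySeq_tendsto_of_complete hcau
    have hgr : (x, y) ∈ A.graph := by
      have hcl := hA.isClosed
      refine hcl.mem_of_tendsto (hx.prodMk_nhds hy) (Filter.Eventually.of_forall fun n => ?_)
      rw [← hv' n]
      exact A.mem_graph (v n)
    obtain ⟨w, -, hw⟩ := (LinearPMap.mem_graph_iff A).mp hgr
    exact ⟨w, hw⟩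
  -- the range is everything
  have htop : LinearMap.range A.toFun = ⊤ := by
    have : CompleteSpace (LinearMap.range A.toFun) := hclosed.completeSpace_coe
    rw [← Submodule.orthogonal_eq_bot_iff, Submodule.eq_bot_iff]
    intro z hz
    have hz' : ∀ x : A.domain, ⟪(0 : E), (x : E)⟫_ℂ = ⟪z, A x⟫_ℂ := by
      intro x
      rw [inner_zero_left]
      exact ((Submodule.mem_orthogonal' _ _).mp hz _ ⟨x, rfl⟩).symm
    have hzd : z ∈ A.adjoint.domain :=
      LinearPMap.mem_adjoint_domain_of_exists z ⟨0, hz'⟩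
    have hAz : A.adjoint ⟨z, hzd⟩ = 0 := LinearPMap.adjoint_apply_eq hdense _ hz'
    have hgr : (z, (0 : E)) ∈ A.adjoint.graph := by
      rw [← hAz]; exact A.adjoint.mem_graph ⟨z, hzd⟩
    rw [LinearPMap.isSelfAdjoint_def.mp hA] at hgr
    obtain ⟨w, hw1, hw2⟩ := (LinearPMap.mem_graph_iff A).mp hgr
    have hw0 : w = 0 := by
      apply hinj
      rw [map_zero]
      exact hw2
    have : (w : E) = z := hw1
    rw [← this, hw0]; rfl
  have hsurj : Function.Surjective A.toFun := LinearMap.range_eq_top.mp htop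
  have hex : ∃ R : E →L[ℂ] E, IsBoundedInverse A R := by
    let e := LinearEquiv.ofBijective A.toFun ⟨hinj, hsurj⟩
    have he : ∀ ψ : E, A (e.symm ψ) = ψ := fun ψ => e.apply_symm_apply ψ
    refine ⟨(A.domain.subtype ∘ₗ e.symm.toLinearMap).mkContinuous m⁻¹ ?_, ?_, ?_⟩
    · intro ψ
      have h1 := hlow (e.symm ψ)
      rw [he] at h1
      rw [inv_mul_eq_div, le_div_iff₀ hm, mul_comm]
      exact h1
    · intro φ
      have : e.symm (e φ) = φ := e.symm_apply_apply φ
      exact congrArg Subtype.val this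
    · intro ψ
      exact ⟨(e.symm ψ).2, he ψ⟩
  unfold invOp
  rw [dif_pos hex]
  exact Classical.choose_spec hex

/-- `e^{-A}` for a self-adjoint operator `A ≥ m > 0`, by the continuous functional calculus of the
bounded positive operator `R = A⁻¹`: one has `e^{-A} = f(R)`, where `f r = e^{-1/r}` for `0 < r`
and `f r = 0` for `r ≤ 0`. -/
noncomputable def expNeg (A : E →ₗ.[ℂ] E) : E →L[ℂ] E :=
  cfc expNegInvGlue (invOp A)

/-- `Z = Tr e^{-A}`. -/
noncomputable def partitionFunction (A : E →ₗ.[ℂ] E) : ℝ :=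
  (opTrace (expNeg A)).re

/-- `ψ = log Z`. -/
noncomputable def freeEnergy (A : E →ₗ.[ℂ] E) : ℝ :=
  Real.log (partitionFunction A)

/-- `ρ = Z⁻¹ e^{-A}`. -/
noncomputable def gibbsState (A : E →ₗ.[ℂ] E) : E →L[ℂ] E :=
  ((partitionFunction A : ℂ)⁻¹) • expNeg A

/-- The operator `A + X` on the domain of `A`. -/
def perturb (A : E →ₗ.[ℂ] E) (X : A.domain →ₗ[ℂ] E) : E →ₗ.[ℂ] E :=
  ⟨A.domain, A.toFun + X⟩

/-- `Tr(ρ Y)` exists and equals `z`, where `ρ` is the Gibbs state of `A`: the operator `ρ Y`,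
defined on the domain of `A`, has a trace-class extension, whose trace is `z`. -/
def HasMean (A : E →ₗ.[ℂ] E) (Y : A.domain →ₗ[ℂ] E) (z : ℂ) : Prop :=
  ∃ T : E →L[ℂ] E, (∀ φ : A.domain, T φ = gibbsState A (Y φ)) ∧ IsTraceClass T ∧ opTrace T = z

end Operators

/-! ### The space of `ω`-directions -/

section Omega

variable {E : Type*} [NormedAddCommGroup E] [InnerProductSpace ℂ E] [CompleteSpace E]

/-- The real vector space of `ω`-directions at `A`: symmetric operators `Y` on the domain of `A`
with `‖R Y‖ < ∞`, where `R = A⁻¹`. -/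
noncomputable def omegaDirections (A : E →ₗ.[ℂ] E) : Submodule ℝ (A.domain →ₗ[ℂ] E) where
  carrier := {Y | (∀ φ χ : A.domain, ⟪Y φ, (χ : E)⟫_ℂ = ⟪(φ : E), Y χ⟫_ℂ) ∧
    Continuous ((invOp A : E →ₗ[ℂ] E) ∘ₗ Y)}
  add_mem' := by
    rintro Y Z ⟨hY, hY'⟩ ⟨hZ, hZ'⟩
    refine ⟨fun φ χ => ?_, ?_⟩
    · simp only [LinearMap.add_apply, inner_add_left, inner_add_right, hY φ χ, hZ φ χ]
    · rw [LinearMap.comp_add]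
      exact hY'.add hZ'
  zero_mem' := by
    refine ⟨fun φ χ => by simp, ?_⟩
    rw [LinearMap.comp_zero]
    exact continuous_zero
  smul_mem' := by
    rintro c Y ⟨hY, hY'⟩
    refine ⟨fun φ χ => ?_, ?_⟩
    · have h : ∀ x : E, c • x = (c : ℂ) • x := fun x => (Complex.coe_smul c x).symm
      simp only [LinearMap.smul_apply, h, inner_smul_left, inner_smul_right, hY φ χ,
        Complex.conj_ofReal]
    · have h : ((invOp A : E →ₗ[ℂ] E) ∘ₗ (c • Y) : A.domain →ₗ[ℂ] E) =
          c • ((invOp A : E →ₗ[ℂ] E) ∘ₗ Y) := by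
        ext φ
        simp
      rw [h]
      exact hY'.const_smul c

/-- `Y ↦ R Y`, as a bounded operator from the domain of `A` (with the norm of `E`) to `E`. -/
noncomputable def omegaEmbedding (A : E →ₗ.[ℂ] E) :
    omegaDirections A →ₗ[ℝ] (A.domain →L[ℂ] E) where
  toFun Y := ⟨(invOp A : E →ₗ[ℂ] E) ∘ₗ Y.1, Y.2.2⟩
  map_add' Y Z := by
    ext φ
    simp
  map_smul' c Y := by
    ext φ
    simp

/-- The `ω`-norm `‖Y‖_ω = ‖R Y‖`. -/
noncomputable instance omegaSeminormed (A : E →ₗ.[ℂ] E) :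
    SeminormedAddCommGroup (omegaDirections A) :=
  SeminormedAddCommGroup.induced _ _ (omegaEmbedding A)

noncomputable instance omegaNormedSpace (A : E →ₗ.[ℂ] E) :
    NormedSpace ℝ (omegaDirections A) :=
  NormedSpace.induced ℝ _ _ (omegaEmbedding A)

/-- For self-adjoint `A ≥ m > 0` the `ω`-norm is a genuine norm. -/
theorem omegaDirections_eq_zero (A : E →ₗ.[ℂ] E) (hA : IsSelfAdjoint A) (m : ℝ) (hm : 0 < m)
    (hge : IsBoundedBelowBy A m) (Y : omegaDirections A) (hY : ‖Y‖ = 0) : Y = 0 := by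
  have hR := invOp_isBoundedInverse A hA m hm hge
  have h0 : omegaEmbedding A Y = 0 := (norm_eq_zero (a := omegaEmbedding A Y)).mp hY
  ext φ
  have h1 : invOp A (Y.1 φ) = 0 := congrArg (fun T : A.domain →L[ℂ] E => T φ) h0
  obtain ⟨h, h2⟩ := hR.2 (Y.1 φ)
  have h3 : (⟨invOp A (Y.1 φ), h⟩ : A.domain) = 0 := Subtype.ext h1
  rw [h3, LinearPMap.map_zero] at h2
  simpa using h2.symm

end Omega

-- Write $A=H_0$. For symmetric $Y$, finiteness of $\|A^{-1}Y\|$ is by duality the relative bound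
-- $\|Y\varphi\|\le\|Y\|_\omega\|A\varphi\|$ (`norm_omega_apply_le`). With relative bound $a<1$, a
-- Neumann series makes $A+Y$ surjective, hence self-adjoint. The same $a$ bounds the quadratic form
-- (`abs_re_inner_le`), so $(1-a)A\le A+Y$ (`katoRellich`). The norms $\|A\varphi\|$ and
-- $\|(A+Y)\varphi\|$ are then equivalent, so the $\omega$-directions at the two operators coincide
-- and their norms are comparable.
--
-- The state at $A$ is compact, so $A^{-1}$ is compact, and so is $(A+X)^{-1}$; both operators have
-- eigenbases and every trace becomes a sum over eigenvalues. Fix $a$ with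
-- $\|X\|_\omega<a<1-\beta_0$ and put $q=\beta_0/(1-a)<1$. Jensen's inequality in an eigenbasis
-- turns the form inequality into $\operatorname{Tr}e^{-q(A+X)}\le\operatorname{Tr}e^{-\beta_0A}$
-- (`tsum_exp_neg_le`). This puts the state in $C_q$ and bounds $\operatorname{Tr}(K^2e^{-K})$
-- uniformly over $K=A+X'$, $\|X'\|_\omega\le a$.
--
-- Differentiability rests on a Klein-type estimate (`abs_tsum_exp_neg_sub_le`). For eigenbases
-- $e_i$ of $K$ and $f_j$ of $K+Y$, with eigenvalues $\lambda_i$ and $\mu_j$, the weights $|\langle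
-- f_j,e_i\rangle|^2$ have row and column sums one. The first-order remainder of
-- $\operatorname{Tr}e^{-K}$ is thus a weighted double sum of scalar Taylor remainders, each at most
-- $(\mu_j-\lambda_i)^2(e^{-\lambda_i}+e^{-\mu_j})$. Since $\langle
-- f_j,Ye_i\rangle=(\mu_j-\lambda_i)\langle f_j,e_i\rangle$, these sum to terms
-- $e^{-\lambda_i}\|Ye_i\|^2$ and $e^{-\mu_j}\|Yf_j\|^2$, which are quadratic in $\|Y\|_\omega$.
-- Taking logarithms gives the derivative $-\operatorname{Tr}(\rho Y)$; `hasMean` supplies the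
-- trace-class extension.

universe u

/-! ### Bounded operators: eigenbases, traces, trace-class criteria -/

section BoundedOperators

variable {E : Type*} [NormedAddCommGroup E] [InnerProductSpace ℂ E] [CompleteSpace E]

/-- The continuous functional calculus acts on eigenvectors by evaluation. -/
theorem cfc_apply_eigenvector {a : E →L[ℂ] E} (ha : IsSelfAdjoint a) {v : E} (hv : v ≠ 0) {t : ℝ}
    (hav : a v = (t : ℂ) • v) (f : ℝ → ℝ) (hf : ContinuousOn f (spectrum ℝ a)) :
    cfc f a v = (f t : ℂ) • v := by
  have ht : t ∈ spectrum ℝ a := by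
    rw [spectrum.mem_iff]
    intro hu
    obtain ⟨b, hb⟩ := hu.exists_left_inv
    have h0 : (algebraMap ℝ (E →L[ℂ] E) t - a) v = 0 := by
      simp [Algebra.algebraMap_eq_smul_one, hav]
    have h1 : (b * (algebraMap ℝ (E →L[ℂ] E) t - a)) v = v := by rw [hb]; simp
    rw [mul_apply_eq_comp, h0, map_zero] at h1
    exact hv h1.symm
  rw [cfc_apply f a ha hf]
  have key : ∀ g : C(spectrum ℝ a, ℝ), cfcHom ha g v = (g ⟨t, ht⟩ : ℂ) • v := by
    intro g
    induction g using ContinuousMap.induction_on_of_compact with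
    | const r =>
      have : cfcHom ha (ContinuousMap.const _ r) = algebraMap ℝ (E →L[ℂ] E) r := by
        have := AlgHomClass.commutes (cfcHom ha) r
        exact this
      rw [this]
      simp [Algebra.algebraMap_eq_smul_one]
    | id =>
      rw [cfcHom_id ha, hav]; rfl
    | star_id =>
      rw [map_star, cfcHom_id ha, ha.star_eq, hav]; rfl
    | add f g hf hg =>
      rw [map_add, add_apply, hf, hg, ← add_smul]; simp
    | mul f g hf hg =>
      rw [map_mul, mul_apply_eq_comp, hg, map_smul, hf, smul_smul]
      simp [mul_comm]
    | frequently f hf =>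
      have hcl : IsClosed {g : C(spectrum ℝ a, ℝ) | cfcHom ha g v = (g ⟨t, ht⟩ : ℂ) • v} := by
        refine isClosed_eq ?_ ?_
        · exact (ContinuousLinearMap.apply ℂ E v).continuous.comp (cfcHom_continuous ha)
        · exact (Complex.continuous_ofReal.comp (continuous_eval_const _)).smul continuous_const
      exact hcl.mem_of_frequently_of_tendsto hf Filter.tendsto_id
  exact key _

variable {ι κ : Type*}

omit [CompleteSpace E] in
theorem HilbertBasis.inner_eq_zero_of_subspace {V : Submodule ℂ E} [CompleteSpace V]
    (B : HilbertBasis ι ℂ V) {x : E} (hx : ∀ i, ⟪x, (B i : E)⟫_ℂ = 0) (y : V) :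
    ⟪x, (y : E)⟫_ℂ = 0 := by
  have h := (B.hasSum_repr y).mapL ((innerSL ℂ x).comp V.subtypeL)
  simp only [map_smul, ContinuousLinearMap.comp_apply, Submodule.subtypeL_apply,
    innerSL_apply_apply, hx, smul_zero] at h
  exact h.unique hasSum_zero

omit [CompleteSpace E] in
theorem eigenspace_isClosed (T : E →L[ℂ] E) (μ : ℂ) :
    IsClosed (Module.End.eigenspace (T : Module.End ℂ E) μ : Set E) := by
  have : (Module.End.eigenspace (T : Module.End ℂ E) μ : Set E) = {x | T x = μ • x} := by
    ext x; exact Module.End.mem_eigenspace_iff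
  rw [this]
  exact isClosed_eq T.continuous (continuous_const_smul μ)

theorem OrthogonalFamily.exists_hilbertBasis_of_iSup {V : ι → Submodule ℂ E}
    [∀ i, CompleteSpace (V i)] (hV : OrthogonalFamily ℂ (fun i => V i) fun i => (V i).subtypeₗᵢ)
    (htop : (⨆ i, V i)ᗮ = ⊥) :
    ∃ (w : ∀ i, Set (V i)) (b : HilbertBasis (Σ i, w i) ℂ E), ∀ k, b k ∈ V k.1 := by
  choose w B hB using fun i => exists_hilbertBasis ℂ (V i)
  have hv : Orthonormal ℂ fun k : Σ i, w i => (V k.1).subtypeₗᵢ (B k.1 k.2) :=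
    hV.orthonormal_sigma_orthonormal fun i => (B i).orthonormal
  have hsp : (Submodule.span ℂ
      (Set.range fun k : Σ i, w i => (V k.1).subtypeₗᵢ (B k.1 k.2)))ᗮ = ⊥ := by
    rw [← le_bot_iff, ← htop]
    intro x hx
    rw [Submodule.mem_orthogonal'] at hx ⊢
    have hle : (⨆ i, V i) ≤ (ℂ ∙ x)ᗮ := by
      refine iSup_le fun i y hy => ?_
      rw [Submodule.mem_orthogonal_singleton_iff_inner_right]
      exact (B i).inner_eq_zero_of_subspace
        (fun k => hx _ (Submodule.subset_span ⟨⟨i, k⟩, rfl⟩)) ⟨y, hy⟩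
    intro u hu
    exact (Submodule.mem_orthogonal_singleton_iff_inner_right).1 (hle hu)
  refine ⟨w, HilbertBasis.mkOfOrthogonalEqBot hv hsp, fun k => ?_⟩
  rw [HilbertBasis.coe_mkOfOrthogonalEqBot]
  exact (B k.1 k.2).2

/-- A compact self-adjoint operator has a Hilbert basis of eigenvectors. -/
theorem IsCompactOperator.exists_hilbertBasis_eigenvectors {E : Type u} [NormedAddCommGroup E]
    [InnerProductSpace ℂ E] [CompleteSpace E] {T : E →L[ℂ] E}
    (hT : IsCompactOperator T) (hsa : IsSelfAdjoint T) :
    ∃ (ι : Type u) (b : HilbertBasis ι ℂ E) (t : ι → ℝ), ∀ i, T (b i) = (t i : ℂ) • b i := by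
  have hsym : (T : E →ₗ[ℂ] E).IsSymmetric := hsa.isSymmetric
  have hVcs : ∀ μ, CompleteSpace (Module.End.eigenspace (T : Module.End ℂ E) μ) :=
    fun μ => (eigenspace_isClosed T μ).completeSpace_coe
  obtain ⟨w, b, hb⟩ := hsym.orthogonalFamily_eigenspaces.exists_hilbertBasis_of_iSup
    (T.orthogonalComplement_iSup_eigenspaces_eq_bot hT hsym)
  refine ⟨Σ μ, w μ, b, fun i => i.1.re, fun i => ?_⟩
  have hev : Module.End.HasEigenvalue (T : Module.End ℂ E) i.1 :=
    Module.End.hasEigenvalue_of_hasEigenvector ⟨hb i, b.orthonormal.ne_zero i⟩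
  rw [Complex.conj_eq_iff_re.1 (hsym.conj_eigenvalue_eq_self hev)]
  exact Module.End.mem_eigenspace_iff.1 (hb i)

omit [CompleteSpace E] in
theorem HilbertBasis.hasSum_norm_inner_sq (b : HilbertBasis ι ℂ E) (x : E) :
    HasSum (fun i => ‖⟪b i, x⟫_ℂ‖ ^ 2) (‖x‖ ^ 2) := by
  have h := b.hasSum_inner_mul_inner x x
  have h2 := Complex.hasSum_re h
  convert h2 using 1
  · ext i
    rw [← inner_conj_symm x (b i), Complex.conj_mul', ← Complex.ofReal_pow, Complex.ofReal_re]
  · rw [inner_self_eq_norm_sq_to_K]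
    simp [← Complex.ofReal_pow]

omit [CompleteSpace E] in
theorem HilbertBasis.hasSum_norm_inner_sq' (b : HilbertBasis ι ℂ E) (x : E) :
    HasSum (fun i => ‖⟪x, b i⟫_ℂ‖ ^ 2) (‖x‖ ^ 2) := by
  simpa only [norm_inner_symm x] using b.hasSum_norm_inner_sq x

omit [CompleteSpace E] in
theorem HilbertBasis.norm_eq_one (b : HilbertBasis ι ℂ E) (i : ι) : ‖b i‖ = 1 :=
  b.orthonormal.1 i

omit [CompleteSpace E] in
theorem HilbertBasis.ne_zero (b : HilbertBasis ι ℂ E) (i : ι) : b i ≠ 0 :=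
  b.orthonormal.ne_zero i

omit [CompleteSpace E] in
/-- A bounded operator that is diagonal in `f` has quadratic form `∑ d_j |⟨f_j, x⟩|²`. -/
theorem HilbertBasis.hasSum_inner_diagonal (f : HilbertBasis κ ℂ E) {D : E →L[ℂ] E} {d : κ → ℝ}
    (hD : ∀ j, D (f j) = (d j : ℂ) • f j) (x : E) :
    HasSum (fun j => ((d j * ‖⟪f j, x⟫_ℂ‖ ^ 2 : ℝ) : ℂ)) ⟪x, D x⟫_ℂ := by
  have h := (f.hasSum_repr x).mapL D |>.mapL (innerSL ℂ x)
  refine HasSum.congr_fun h fun j => ?_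
  rw [map_smul, hD, map_smul, map_smul, f.repr_apply_apply]
  simp only [innerSL_apply_apply, smul_eq_mul]
  rw [← inner_conj_symm x (f j)]
  push_cast
  rw [← Complex.conj_mul']
  ring

-- Tonelli for $d_j|\langle f_j,b_i\rangle|^2$: summing over $j$ gives the quadratic form at $b_i$,
-- summing over $i$ gives $d_j$. This frees the trace conditions from the fixed basis `onBasis`.
omit [CompleteSpace E] in
theorem HilbertBasis.summable_re_inner_diagonal_iff (b : HilbertBasis ι ℂ E)
    (f : HilbertBasis κ ℂ E) {D : E →L[ℂ] E} {d : κ → ℝ} (hd : ∀ j, 0 ≤ d j)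
    (hD : ∀ j, D (f j) = (d j : ℂ) • f j) :
    (Summable fun i => (⟪b i, D (b i)⟫_ℂ).re) ↔ Summable d := by
  have hrow : ∀ i, HasSum (fun j => d j * ‖⟪f j, b i⟫_ℂ‖ ^ 2) (⟪b i, D (b i)⟫_ℂ).re := fun i =>
    (Complex.hasSum_re (f.hasSum_inner_diagonal hD (b i)))
  have hcol : ∀ j, HasSum (fun i => d j * ‖⟪f j, b i⟫_ℂ‖ ^ 2) (d j) := fun j => by
    simpa [f.norm_eq_one] using (b.hasSum_norm_inner_sq' (f j)).mul_left (d j)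
  have h1 := summable_prod_of_nonneg (f := fun p : ι × κ => d p.2 * ‖⟪f p.2, b p.1⟫_ℂ‖ ^ 2)
    (fun p => mul_nonneg (hd _) (sq_nonneg _))
  have h2 := summable_prod_of_nonneg (f := fun p : κ × ι => d p.1 * ‖⟪f p.1, b p.2⟫_ℂ‖ ^ 2)
    (fun p => mul_nonneg (hd _) (sq_nonneg _))
  have h3 := (Equiv.prodComm ι κ).summable_iff
    (f := fun p : κ × ι => d p.1 * ‖⟪f p.1, b p.2⟫_ℂ‖ ^ 2)
  have h4 : ((fun p : κ × ι => d p.1 * ‖⟪f p.1, b p.2⟫_ℂ‖ ^ 2) ∘ ⇑(Equiv.prodComm ι κ)) =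
      fun p : ι × κ => d p.2 * ‖⟪f p.2, b p.1⟫_ℂ‖ ^ 2 := rfl
  rw [h4] at h3
  rw [h3, h2] at h1
  simp only [fun i => (hrow i).tsum_eq, fun j => (hcol j).tsum_eq] at h1
  exact ⟨fun h => (h1.2 ⟨fun i => (hrow i).summable, h⟩).2,
    fun h => (h1.1 ⟨fun j => (hcol j).summable, h⟩).2⟩

omit [CompleteSpace E] in
/-- If `T^* f_j = w_j y_j` with `∑ w_j (1 + ‖y_j‖²) < ∞`, then `∑ ⟨b_i, T b_i⟩ = ∑ w_j ⟨y_j, f_j⟩`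
for every Hilbert basis `b`. -/
theorem HilbertBasis.hasSum_inner_apply_of_adjoint (b : HilbertBasis ι ℂ E)
    (f : HilbertBasis κ ℂ E) {T : E →L[ℂ] E} {w : κ → ℝ} {y : κ → E} (hw : ∀ j, 0 ≤ w j)
    (hT : ∀ j x, ⟪f j, T x⟫_ℂ = w j * ⟪y j, x⟫_ℂ)
    (hs : Summable fun j => w j * (1 + ‖y j‖ ^ 2)) :
    HasSum (fun i => ⟪b i, T (b i)⟫_ℂ) (∑' j, (w j : ℂ) * ⟪y j, f j⟫_ℂ) := by
  -- `F` is to be summed in both orders. Since $|uv|\le|u|^2+|v|^2$, it is dominated by `G`, whose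
  -- sum over the second index is $w_j(1+\|y_j\|^2)$ by Parseval.
  let F : κ × ι → ℂ := fun p => ⟪b p.2, f p.1⟫_ℂ * (w p.1 * ⟪y p.1, b p.2⟫_ℂ)
  let G : κ × ι → ℝ := fun p => w p.1 * (‖⟪f p.1, b p.2⟫_ℂ‖ ^ 2 + ‖⟪y p.1, b p.2⟫_ℂ‖ ^ 2)
  have hG : Summable G := by
    have hcol : ∀ j, HasSum (fun i => G (j, i)) (w j * (1 + ‖y j‖ ^ 2)) := fun j => by
      simpa [f.norm_eq_one] using
        ((b.hasSum_norm_inner_sq' (f j)).add (b.hasSum_norm_inner_sq' (y j))).mul_left (w j)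
    refine (summable_prod_of_nonneg fun p => ?_).2 ⟨fun j => (hcol j).summable, ?_⟩
    · exact mul_nonneg (hw _) (by positivity)
    · simpa only [fun j => (hcol j).tsum_eq] using hs
  have hF : Summable F := by
    refine Summable.of_norm_bounded hG fun p => ?_
    simp only [F, G, norm_mul, Complex.norm_real, Real.norm_of_nonneg (hw _),
      norm_inner_symm (b p.2)]
    nlinarith [mul_nonneg (hw p.1) (sq_nonneg (‖⟪f p.1, b p.2⟫_ℂ‖ - ‖⟪y p.1, b p.2⟫_ℂ‖)),
      mul_nonneg (hw p.1) (sq_nonneg ‖⟪f p.1, b p.2⟫_ℂ‖),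
      mul_nonneg (hw p.1) (sq_nonneg ‖⟪y p.1, b p.2⟫_ℂ‖)]
  have hcol : ∀ j, HasSum (fun i => F (j, i)) ((w j : ℂ) * ⟪y j, f j⟫_ℂ) := fun j => by
    have := (b.hasSum_inner_mul_inner (y j) (f j)).mul_left (w j : ℂ)
    refine HasSum.congr_fun this fun i => ?_
    simp only [F]
    ring
  have hrow : ∀ i, HasSum (fun j => F (j, i)) ⟪b i, T (b i)⟫_ℂ := fun i => by
    have := f.hasSum_inner_mul_inner (b i) (T (b i))
    simpa only [hT] using this
  have h1 : HasSum F (∑' j, (w j : ℂ) * ⟪y j, f j⟫_ℂ) := by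
    have := hF.hasSum.prod_fiberwise hcol
    rw [this.tsum_eq]
    exact hF.hasSum
  exact ((Equiv.prodComm ι κ).hasSum_iff.2 h1).prod_fiberwise hrow

theorem opTrace_of_diagonal (f : HilbertBasis κ ℂ E) {D : E →L[ℂ] E} {d : κ → ℝ}
    (hd : ∀ j, 0 ≤ d j) (hD : ∀ j, D (f j) = (d j : ℂ) • f j) (hsa : IsSelfAdjoint D)
    (hs : Summable d) : opTrace D = ((∑' j, d j : ℝ) : ℂ) := by
  have h := (onBasis E).hasSum_inner_apply_of_adjoint f (T := D) (y := f) hd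
    (fun j x => by
      have h1 : ⟪D (f j), x⟫_ℂ = ⟪f j, D x⟫_ℂ := hsa.isSymmetric (f j) x
      rw [← h1, hD, inner_smul_left,
        Complex.conj_ofReal])
    (by simpa [f.norm_eq_one] using hs.mul_right 2 |>.congr fun j => by norm_num)
  rw [opTrace, h.tsum_eq, Complex.ofReal_tsum]
  refine tsum_congr fun j => ?_
  rw [inner_self_eq_norm_sq_to_K, f.norm_eq_one]
  simp

theorem abs_apply_eigenvector {T : E →L[ℂ] E} {v : E} (hv : v ≠ 0) {s : ℝ}
    (h : (star T * T) v = ((s ^ 2 : ℝ) : ℂ) • v) : CFC.abs T v = ((|s| : ℝ) : ℂ) • v := by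
  have hnn : (0 : E →L[ℂ] E) ≤ star T * T := star_mul_self_nonneg T
  rw [CFC.abs, CFC.sqrt_eq_real_sqrt _ hnn, cfcₙ_eq_cfc,
    cfc_apply_eigenvector hnn.isSelfAdjoint hv h _ (Real.continuous_sqrt.continuousOn),
    Real.sqrt_sq_eq_abs]

theorem isTraceClass_iff_of_diagonal (f : HilbertBasis κ ℂ E) {T : E →L[ℂ] E} {s : κ → ℝ}
    (h : ∀ j, (star T * T) (f j) = ((s j ^ 2 : ℝ) : ℂ) • f j) :
    IsTraceClass T ↔ Summable fun j => |s j| :=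
  (onBasis E).summable_re_inner_diagonal_iff f (fun j => abs_nonneg (s j))
    fun j => abs_apply_eigenvector (f.ne_zero j) (h j)

-- Same domination as for the trace, with Bessel in place of Parseval. Two different orthonormal
-- families are allowed so that the partial isometry of a polar decomposition can be absorbed into
-- one of them.
omit [CompleteSpace E] in
theorem summable_inner_apply_of_adjoint {J : Type*} (f : HilbertBasis κ ℂ E) {T : E →L[ℂ] E}
    {w : κ → ℝ} {y : κ → E} (hw : ∀ j, 0 ≤ w j) (hT : ∀ j x, ⟪f j, T x⟫_ℂ = w j * ⟪y j, x⟫_ℂ)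
    (hs : Summable fun j => w j * (1 + ‖y j‖ ^ 2)) {u v : J → E} (hu : Orthonormal ℂ u)
    (hv : Orthonormal ℂ v) : Summable fun l => (⟪u l, T (v l)⟫_ℂ).re := by
  let F : κ × J → ℝ := fun p => w p.1 * (‖⟪u p.2, f p.1⟫_ℂ‖ ^ 2 + ‖⟪v p.2, y p.1⟫_ℂ‖ ^ 2)
  have hF0 : 0 ≤ F := fun p => mul_nonneg (hw _) (by positivity)
  have hb1 : ∀ j, Summable fun l : J => ‖⟪u l, f j⟫_ℂ‖ ^ 2 := fun j =>
    hu.inner_products_summable (f j)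
  have hy1 : ∀ j, Summable fun l : J => ‖⟪v l, y j⟫_ℂ‖ ^ 2 := fun j =>
    hv.inner_products_summable (y j)
  have hF : Summable F := by
    refine (summable_prod_of_nonneg hF0).2 ⟨fun j => ((hb1 j).add (hy1 j)).mul_left (w j), ?_⟩
    refine Summable.of_nonneg_of_le (fun j => tsum_nonneg fun l => hF0 (j, l)) (fun j => ?_) hs
    simp only [F]
    rw [tsum_mul_left, (hb1 j).tsum_add (hy1 j)]
    refine mul_le_mul_of_nonneg_left (add_le_add ?_ (hv.tsum_inner_products_le (y j))) (hw j)
    have := hu.tsum_inner_products_le (f j)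
    rwa [f.norm_eq_one, one_pow] at this
  have hF' : Summable fun p : J × κ => F (p.2, p.1) :=
    (Equiv.prodComm J κ).summable_iff.2 hF
  have h1 := (summable_prod_of_nonneg fun p : J × κ => hF0 (p.2, p.1)).1 hF'
  have hterm : ∀ l j, ‖⟪u l, f j⟫_ℂ * ⟪f j, T (v l)⟫_ℂ‖ ≤ F (j, l) := by
    intro l j
    simp only [F, hT, norm_mul, Complex.norm_real, Real.norm_of_nonneg (hw _)]
    rw [norm_inner_symm (y j)]
    nlinarith [mul_nonneg (hw j) (sq_nonneg (‖⟪u l, f j⟫_ℂ‖ - ‖⟪v l, y j⟫_ℂ‖)),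
      mul_nonneg (hw j) (sq_nonneg ‖⟪u l, f j⟫_ℂ‖), mul_nonneg (hw j) (sq_nonneg ‖⟪v l, y j⟫_ℂ‖)]
  refine Summable.of_norm_bounded h1.2 fun l => ?_
  rw [Real.norm_eq_abs]
  refine (Complex.abs_re_le_norm _).trans ?_
  rw [← (f.hasSum_inner_mul_inner (u l) (T (v l))).tsum_eq]
  exact tsum_of_norm_bounded (h1.1 l).hasSum (hterm l)

/-- Operators with `T^* f_j = w_j y_j` and `∑ w_j (1 + ‖y_j‖²) < ∞` are trace class. -/
theorem isTraceClass_of_adjoint (f : HilbertBasis κ ℂ E) {T : E →L[ℂ] E}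
    (hcomp : IsCompactOperator T) {w : κ → ℝ} {y : κ → E}
    (hw : ∀ j, 0 ≤ w j) (hT : ∀ j x, ⟪f j, T x⟫_ℂ = w j * ⟪y j, x⟫_ℂ)
    (hs : Summable fun j => w j * (1 + ‖y j‖ ^ 2)) : IsTraceClass T := by
  have hsa : IsSelfAdjoint (star T * T) := IsSelfAdjoint.star_mul_self T
  have hc : IsCompactOperator (star T * T : E →L[ℂ] E) := hcomp.clm_comp (star T)
  obtain ⟨ι, h, t, ht⟩ := hc.exists_hilbertBasis_eigenvectors hsa
  have hin : ∀ i x, ⟪T (h i), T x⟫_ℂ = t i * ⟪h i, x⟫_ℂ := by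
    intro i x
    rw [← ContinuousLinearMap.adjoint_inner_left]
    have : (ContinuousLinearMap.adjoint T) (T (h i)) = (t i : ℂ) • h i := ht i
    rw [this, inner_smul_left, Complex.conj_ofReal]
  have hnorm : ∀ i, ‖T (h i)‖ ^ 2 = t i := by
    intro i
    have h1 := hin i (h i)
    rw [inner_self_eq_norm_sq_to_K, inner_self_eq_norm_sq_to_K, h.norm_eq_one] at h1
    simp only [Complex.coe_algebraMap, Complex.ofReal_one, one_pow, mul_one] at h1
    exact_mod_cast h1
  rw [isTraceClass_iff_of_diagonal h (s := fun i => ‖T (h i)‖) fun i => by rw [hnorm]; exact ht i]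
  simp only [abs_norm]
  -- In an eigenbasis $h_i$ of $T^*T$ the trace of $|T|$ is $\sum\|Th_i\|$. Off the kernel,
  -- $u_i=Th_i/\|Th_i\|$ is orthonormal and $\|Th_i\|=\langle u_i,Th_i\rangle$.
  let J : Set ι := {i | T (h i) ≠ 0}
  let u : J → E := fun i => ((‖T (h i)‖⁻¹ : ℝ) : ℂ) • T (h i)
  have hu : Orthonormal ℂ u := by
    constructor
    · intro i
      have : ‖T (h i)‖ ≠ 0 := norm_ne_zero_iff.2 i.2
      change ‖((‖T (h i)‖⁻¹ : ℝ) : ℂ) • T (h i)‖ = 1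
      rw [norm_smul, Complex.norm_real, norm_inv, norm_norm, inv_mul_cancel₀ this]
    · intro i j hij
      have hij' : (i : ι) ≠ j := fun h' => hij (Subtype.ext h')
      change ⟪((‖T (h i)‖⁻¹ : ℝ) : ℂ) • T (h i), ((‖T (h j)‖⁻¹ : ℝ) : ℂ) • T (h j)⟫_ℂ = 0
      rw [inner_smul_left, inner_smul_right, hin, h.orthonormal.2 hij']
      simp
  have hsupp : ∀ i, i ∉ Set.range ((↑) : J → ι) → ‖T (h i)‖ = 0 := by
    intro i hi
    rw [Subtype.range_coe] at hi
    rw [norm_eq_zero]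
    exact not_not.1 hi
  rw [← Function.Injective.summable_iff (Subtype.val_injective (p := (· ∈ J))) hsupp]
  refine (summable_inner_apply_of_adjoint f hw hT hs hu
    (h.orthonormal.comp ((↑) : J → ι) Subtype.val_injective)).congr fun l => ?_
  have hl : ‖T (h l)‖ ≠ 0 := norm_ne_zero_iff.2 l.2
  change (⟪((‖T (h l)‖⁻¹ : ℝ) : ℂ) • T (h l), T (h l)⟫_ℂ).re = ‖T (h l)‖
  rw [inner_smul_left, inner_self_eq_norm_sq_to_K, Complex.conj_ofReal]
  change ((((‖T (h l)‖⁻¹ : ℝ) : ℂ) * (‖T (h l)‖ : ℂ) ^ 2).re = _)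
  rw [← Complex.ofReal_pow, ← Complex.ofReal_mul, Complex.ofReal_re]
  field_simp

/-- If `f > 0` on `(0, ∞)` and `f(a)` is compact for a positive operator `a`, so is `a`. -/
theorem isCompactOperator_of_cfc {a : E →L[ℂ] E} (ha : 0 ≤ a) {f : ℝ → ℝ} (hf : Continuous f)
    (hpos : ∀ x, 0 < x → 0 < f x) (hc : IsCompactOperator (cfc f a : E →L[ℂ] E)) : IsCompactOperator a := by
  have hsa : IsSelfAdjoint a := ha.isSelfAdjoint
  have hspec : ∀ x ∈ spectrum ℝ a, 0 ≤ x := fun x hx => spectrum_nonneg_of_nonneg ha hx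
  have key : ∀ ε : ℝ, 0 < ε → ∃ S : E →L[ℂ] E, IsCompactOperator S ∧ ‖a - S‖ ≤ ε := by
    intro ε hε
    -- On the spectrum $q(x)f(x)=(x-\varepsilon)_+$, so the compact operator $q(a)f(a)$ lies within
    -- $\varepsilon$ of $a$. The `max` in the denominator keeps $f$ away from $0$, where it may
    -- vanish.
    let q : ℝ → ℝ := fun x => max (x - ε) 0 / f (max x ε)
    have hq : Continuous q := by
      refine Continuous.div (by fun_prop) (hf.comp (by fun_prop)) fun x => ?_
      exact (hpos _ (lt_max_of_lt_right hε)).ne'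
    refine ⟨cfc q a * cfc f a, hc.clm_comp (cfc q a), ?_⟩
    rw [← cfc_mul q f a hq.continuousOn hf.continuousOn]
    nth_rewrite 1 [← cfc_id' ℝ a hsa]
    rw [← cfc_sub (fun x : ℝ => x) (fun x => q x * f x) a continuousOn_id
      (hq.mul hf).continuousOn]
    refine norm_cfc_le hε.le fun x hx => ?_
    have hx0 := hspec x hx
    rw [Real.norm_eq_abs]
    simp only [q]
    rcases le_total ε x with h | h
    · rw [max_eq_left (by linarith), max_eq_left h, div_mul_cancel₀ _ (hpos x (by linarith)).ne']
      rw [abs_le]; constructor <;> linarith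
    · rw [max_eq_right (by linarith : x - ε ≤ 0)]
      rw [zero_div, zero_mul, sub_zero, abs_of_nonneg hx0]; exact h
  have hcl : IsClosed {S : E →L[ℂ] E | IsCompactOperator S} := isClosed_setOfPred_isCompactOperator
  have : a ∈ closure {S : E →L[ℂ] E | IsCompactOperator S} := by
    rw [Metric.mem_closure_iff]
    intro ε hε
    obtain ⟨S, hS, h⟩ := key (ε / 2) (half_pos hε)
    exact ⟨S, hS, by rw [dist_eq_norm]; linarith⟩
  rw [hcl.closure_eq] at this
  exact this

end BoundedOperators

/-! ### Positive self-adjoint operators and relative boundedness -/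

section Unbounded

variable {E : Type*} [NormedAddCommGroup E] [InnerProductSpace ℂ E] [CompleteSpace E]

omit [CompleteSpace E] in
theorem norm_inner_self_eq_mul (x : E) : ‖⟪x, x⟫_ℂ‖ = ‖x‖ * ‖x‖ := by
  rw [inner_self_eq_norm_sq_to_K]
  simp [sq]

/-- Self-adjoint operators bounded below by a positive constant. -/
structure LinearPMap.IsPosSelfAdjoint (A : E →ₗ.[ℂ] E) : Prop where
  isSelfAdjoint : IsSelfAdjoint A
  exists_bound : ∃ m : ℝ, 0 < m ∧ IsBoundedBelowBy A m

namespace LinearPMap.IsPosSelfAdjoint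

variable {A : E →ₗ.[ℂ] E} (hA : A.IsPosSelfAdjoint)
include hA

theorem isBoundedInverse : IsBoundedInverse A (invOp A) := by
  obtain ⟨m, hm, h⟩ := hA.exists_bound
  exact invOp_isBoundedInverse A hA.isSelfAdjoint m hm h

theorem dense : Dense (A.domain : Set E) := hA.isSelfAdjoint.dense_domain

theorem symm (x y : A.domain) : ⟪A x, (y : E)⟫_ℂ = ⟪(x : E), A y⟫_ℂ := by
  have h := LinearPMap.adjoint_isFormalAdjoint hA.dense
  rw [LinearPMap.isSelfAdjoint_def.mp hA.isSelfAdjoint] at h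
  exact h x y

theorem inv_mem (ψ : E) : invOp A ψ ∈ A.domain := (hA.isBoundedInverse.2 ψ).1

theorem apply_inv (ψ : E) : A ⟨invOp A ψ, hA.inv_mem ψ⟩ = ψ := (hA.isBoundedInverse.2 ψ).2

theorem inv_apply (φ : A.domain) : invOp A (A φ) = φ := hA.isBoundedInverse.1 φ

theorem inner_inv (x y : E) : ⟪invOp A x, y⟫_ℂ = ⟪x, invOp A y⟫_ℂ := by
  have h := hA.symm ⟨_, hA.inv_mem x⟩ ⟨_, hA.inv_mem y⟩
  rw [hA.apply_inv, hA.apply_inv] at h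
  exact h.symm

theorem re_inner_nonneg (φ : A.domain) : 0 ≤ (⟪(φ : E), A φ⟫_ℂ).re := by
  obtain ⟨m, hm, h⟩ := hA.exists_bound
  exact (by positivity : 0 ≤ m * ‖(φ : E)‖ ^ 2).trans (h φ)

theorem inv_nonneg : 0 ≤ invOp A := by
  rw [ContinuousLinearMap.nonneg_iff_isPositive]
  refine ⟨fun x y => hA.inner_inv x y, fun x => ?_⟩
  have h := hA.re_inner_nonneg ⟨_, hA.inv_mem x⟩
  rw [hA.apply_inv] at h
  rw [ContinuousLinearMap.reApplyInnerSelf_apply]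
  exact h

theorem isSelfAdjoint_inv : IsSelfAdjoint (invOp A) := hA.inv_nonneg.isSelfAdjoint

/-- The bounded operator `Y A⁻¹` for a relatively bounded `Y`. -/
theorem exists_comp_inv {Y : A.domain →ₗ[ℂ] E} {C : ℝ} (hY : ∀ φ, ‖Y φ‖ ≤ C * ‖A φ‖) :
    ∃ S : E →L[ℂ] E, (∀ ψ, S ψ = Y ⟨invOp A ψ, hA.inv_mem ψ⟩) ∧ ∀ ψ, ‖S ψ‖ ≤ C * ‖ψ‖ := by
  have hb : ∀ ψ, ‖Y ⟨invOp A ψ, hA.inv_mem ψ⟩‖ ≤ C * ‖ψ‖ := fun ψ => by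
    simpa only [hA.apply_inv] using hY ⟨invOp A ψ, hA.inv_mem ψ⟩
  exact ⟨(Y ∘ₗ (invOp A : E →ₗ[ℂ] E).codRestrict A.domain hA.inv_mem).mkContinuous C hb,
    fun _ => rfl, hb⟩

/-- An `ω`-direction is relatively bounded with relative bound its `ω`-norm. -/
theorem norm_omega_apply_le (Y : omegaDirections A) (φ : A.domain) :
    ‖Y.1 φ‖ ≤ ‖Y‖ * ‖A φ‖ := by
  -- Symmetry gives $\langle Y\varphi,\chi\rangle=\langle A\varphi,A^{-1}Y\chi\rangle$. The bound
  -- extends from the dense domain to $\chi=Y\varphi$.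
  have h1 : ∀ χ : A.domain, ‖⟪Y.1 φ, (χ : E)⟫_ℂ‖ ≤ ‖Y‖ * ‖A φ‖ * ‖(χ : E)‖ := by
    intro χ
    have h2 : ⟪Y.1 φ, (χ : E)⟫_ℂ = ⟪A φ, omegaEmbedding A Y χ⟫_ℂ := by
      change _ = ⟪A φ, invOp A (Y.1 χ)⟫_ℂ
      rw [Y.2.1, ← hA.inner_inv, hA.inv_apply]
    rw [h2]
    refine (norm_inner_le_norm _ _).trans ?_
    have h3 : ‖omegaEmbedding A Y χ‖ ≤ ‖Y‖ * ‖(χ : E)‖ :=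
      (omegaEmbedding A Y).le_opNorm χ
    nlinarith [norm_nonneg (A φ)]
  have hcl : _root_.IsClosed {x : E | ‖⟪Y.1 φ, x⟫_ℂ‖ ≤ ‖Y‖ * ‖A φ‖ * ‖x‖} :=
    isClosed_le (by fun_prop) (by fun_prop)
  have h4 : Y.1 φ ∈ {x : E | ‖⟪Y.1 φ, x⟫_ℂ‖ ≤ ‖Y‖ * ‖A φ‖ * ‖x‖} :=
    closure_minimal (fun x hx => h1 ⟨x, hx⟩) hcl (hA.dense (Y.1 φ))
  have h5 : ‖Y.1 φ‖ * ‖Y.1 φ‖ ≤ ‖Y‖ * ‖A φ‖ * ‖Y.1 φ‖ := by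
    have h6 : ‖⟪Y.1 φ, Y.1 φ⟫_ℂ‖ ≤ ‖Y‖ * ‖A φ‖ * ‖Y.1 φ‖ := h4
    rwa [norm_inner_self_eq_mul] at h6
  rcases (norm_nonneg (Y.1 φ)).eq_or_lt with h | h
  · rw [← h]; positivity
  · exact le_of_mul_le_mul_right h5 h

/-- The converse duality: $A^{-1}Y$ is the formal adjoint of $YA^{-1}$, so pairing $A^{-1}Y\varphi$
with itself moves $Y$ to the other side. -/
theorem norm_inv_apply_le {Y : A.domain →ₗ[ℂ] E}
    (hs : ∀ φ χ : A.domain, ⟪Y φ, (χ : E)⟫_ℂ = ⟪(φ : E), Y χ⟫_ℂ) {C : ℝ} (hC : 0 ≤ C)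
    (hY : ∀ φ, ‖Y φ‖ ≤ C * ‖A φ‖) (φ : A.domain) : ‖invOp A (Y φ)‖ ≤ C * ‖(φ : E)‖ := by
  have h1 : ⟪invOp A (Y φ), invOp A (Y φ)⟫_ℂ =
      ⟪(φ : E), Y ⟨_, hA.inv_mem (invOp A (Y φ))⟩⟫_ℂ := by
    rw [hA.inner_inv, ← hs]
  have h2 := hY ⟨_, hA.inv_mem (invOp A (Y φ))⟩
  rw [hA.apply_inv] at h2
  have h3 : ‖invOp A (Y φ)‖ * ‖invOp A (Y φ)‖ ≤ C * ‖(φ : E)‖ * ‖invOp A (Y φ)‖ := by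
    rw [← norm_inner_self_eq_mul, h1]
    refine (norm_inner_le_norm _ _).trans ?_
    nlinarith [norm_nonneg (φ : E)]
  rcases (norm_nonneg (invOp A (Y φ))).eq_or_lt with h | h
  · rw [← h]; positivity
  · exact le_of_mul_le_mul_right h3 h

/-- A criterion through $\|A\varphi\|$ instead of $A^{-1}$, which is easy to compare for two
operators on one domain. -/
theorem mem_omegaDirections_iff (Y : A.domain →ₗ[ℂ] E) :
    Y ∈ omegaDirections A ↔ (∀ φ χ : A.domain, ⟪Y φ, (χ : E)⟫_ℂ = ⟪(φ : E), Y χ⟫_ℂ) ∧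
      ∃ C : ℝ, ∀ φ, ‖Y φ‖ ≤ C * ‖A φ‖ := by
  refine ⟨fun h => ⟨h.1, _, hA.norm_omega_apply_le ⟨Y, h⟩⟩, fun ⟨hs, C, hC⟩ => ⟨hs, ?_⟩⟩
  exact AddMonoidHomClass.continuous_of_bound ((invOp A : E →ₗ[ℂ] E) ∘ₗ Y) |C|
    fun φ => hA.norm_inv_apply_le hs (abs_nonneg C)
      (fun φ => (hC φ).trans (mul_le_mul_of_nonneg_right (le_abs_self C) (norm_nonneg _))) φ

theorem omega_norm_le (Y : omegaDirections A) {C : ℝ} (hC : 0 ≤ C)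
    (hY : ∀ φ, ‖Y.1 φ‖ ≤ C * ‖A φ‖) : ‖Y‖ ≤ C :=
  (omegaEmbedding A Y).opNorm_le_bound hC fun φ => hA.norm_inv_apply_le Y.2.1 hC hY φ

end LinearPMap.IsPosSelfAdjoint

/-- A densely defined symmetric surjective operator is self-adjoint. -/
theorem LinearPMap.isSelfAdjoint_of_surjective {A : E →ₗ.[ℂ] E} (hd : Dense (A.domain : Set E))
    (hs : ∀ x y : A.domain, ⟪A x, (y : E)⟫_ℂ = ⟪(x : E), A y⟫_ℂ)
    (hsurj : ∀ ψ : E, ∃ φ : A.domain, A φ = ψ) : IsSelfAdjoint A := by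
  rw [LinearPMap.isSelfAdjoint_def]
  have hle : A ≤ A.adjoint := LinearPMap.IsFormalAdjoint.le_adjoint hd hs
  refine (LinearPMap.eq_of_le_of_domain_eq hle (le_antisymm hle.1 fun y hy => ?_)).symm
  obtain ⟨φ, hφ⟩ := hsurj (A.adjoint ⟨y, hy⟩)
  -- With $A\varphi=A^*y$, the vector $y-\varphi$ is orthogonal to the range of $A$, which is
  -- everything.
  have h1 : ∀ χ : A.domain, ⟪y - φ, A χ⟫_ℂ = 0 := by
    intro χ
    have h2 : ⟪A.adjoint ⟨y, hy⟩, (χ : E)⟫_ℂ = ⟪y, A χ⟫_ℂ :=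
      LinearPMap.adjoint_isFormalAdjoint hd ⟨y, hy⟩ χ
    rw [inner_sub_left, ← h2, ← hφ, hs, sub_self]
  obtain ⟨χ, hχ⟩ := hsurj (y - φ)
  have h3 := h1 χ
  rw [hχ, inner_self_eq_zero, sub_eq_zero] at h3
  rw [h3]
  exact φ.2

/-! ### Form bounds from operator bounds -/

section Form

variable {A : E →ₗ.[ℂ] E} (hA : A.IsPosSelfAdjoint)
include hA

/-- Cauchy–Schwarz for the form of $A$, from the discriminant of
$t\mapsto\langle\varphi+t\chi,A(\varphi+t\chi)\rangle\ge0$. -/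
theorem LinearPMap.IsPosSelfAdjoint.re_inner_sq_le (φ χ : A.domain) :
    (⟪(φ : E), A χ⟫_ℂ).re ^ 2 ≤ (⟪(φ : E), A φ⟫_ℂ).re * (⟪(χ : E), A χ⟫_ℂ).re := by
  have hsym : (⟪(χ : E), A φ⟫_ℂ).re = (⟪(φ : E), A χ⟫_ℂ).re := by
    rw [← hA.symm, ← inner_conj_symm, Complex.conj_re]
  have h : ∀ t : ℝ, 0 ≤ (⟪(χ : E), A χ⟫_ℂ).re * (t * t) + 2 * (⟪(φ : E), A χ⟫_ℂ).re * t +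
      (⟪(φ : E), A φ⟫_ℂ).re := by
    intro t
    have h := hA.re_inner_nonneg (φ + (t : ℂ) • χ)
    rw [LinearPMap.map_add, LinearPMap.map_smul, Submodule.coe_add, Submodule.coe_smul,
      inner_add_left, inner_add_right, inner_add_right, inner_smul_left, inner_smul_left,
      inner_smul_right, inner_smul_right, Complex.conj_ofReal] at h
    simp only [Complex.add_re, Complex.re_ofReal_mul, hsym] at h
    linarith
  have := discrim_le_zero h
  rw [discrim] at this
  nlinarith

/-- The relative bound of a symmetric operator is also a relative form bound. -/
theorem LinearPMap.IsPosSelfAdjoint.abs_re_inner_le {Y : A.domain →ₗ[ℂ] E}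
    (hs : ∀ φ χ : A.domain, ⟪Y φ, (χ : E)⟫_ℂ = ⟪(φ : E), Y χ⟫_ℂ) {a : ℝ} (ha : 0 < a)
    (hY : ∀ φ, ‖Y φ‖ ≤ a * ‖A φ‖) (φ : A.domain) :
    |(⟪(φ : E), Y φ⟫_ℂ).re| ≤ a * (⟪(φ : E), A φ⟫_ℂ).re := by
  -- $T=A^{-1}Y$ is symmetric for the form $\langle\varphi,A\chi\rangle$ and has norm at most $a$ on
  -- $E$. Put $c_n=\operatorname{Re}\langle T^n\varphi,A\varphi\rangle$ and $q=c_0$. Cauchy–Schwarz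
  -- gives $c_n^2\le c_{2n}q$, so $|c_1|=raq$ with $r>1$ would force $c_{2^k}\ge(ra)^{2^k}q$ for
  -- $k\ge1$, against $c_n\le a^n\|\varphi\|\|A\varphi\|$.
  let T : A.domain →ₗ[ℂ] A.domain :=
    (invOp A : E →ₗ[ℂ] E).codRestrict A.domain hA.inv_mem ∘ₗ Y
  have hT : ∀ χ, (T χ : E) = invOp A (Y χ) := fun _ => rfl
  have hAT : ∀ χ, A (T χ) = Y χ := fun χ => hA.apply_inv (Y χ)
  have hTs : ∀ φ χ : A.domain, ⟪(T φ : E), A χ⟫_ℂ = ⟪(φ : E), A (T χ)⟫_ℂ := by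
    intro φ χ
    rw [hAT, hT, hA.inner_inv, hA.inv_apply, hs]
  have hTn : ∀ n (φ χ : A.domain), ⟪((T ^ n) φ : E), A χ⟫_ℂ = ⟪(φ : E), A ((T ^ n) χ)⟫_ℂ := by
    intro n
    induction n with
    | zero => intro φ χ; rfl
    | succ n ih =>
      intro φ χ
      rw [pow_succ, Module.End.mul_apply, ih, hTs, ← Module.End.mul_apply, ← pow_succ', pow_succ]
  have hbd : ∀ n, ‖((T ^ n) φ : E)‖ ≤ a ^ n * ‖(φ : E)‖ := by
    intro n
    induction n with
    | zero => simp
    | succ n ih =>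
      rw [pow_succ', Module.End.mul_apply, hT, pow_succ', mul_assoc]
      exact (hA.norm_inv_apply_le hs ha.le hY _).trans (mul_le_mul_of_nonneg_left ih ha.le)
  let c : ℕ → ℝ := fun n => (⟪((T ^ n) φ : E), A φ⟫_ℂ).re
  let q : ℝ := (⟪(φ : E), A φ⟫_ℂ).re
  have hq : 0 ≤ q := hA.re_inner_nonneg φ
  have hc1 : c 1 = (⟪(φ : E), Y φ⟫_ℂ).re := by
    simp only [c]
    rw [pow_one, hTs, hAT]
  have hcsq : ∀ n, c n ^ 2 ≤ c (n + n) * q := by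
    intro n
    have h := hA.re_inner_sq_le ((T ^ n) φ) φ
    rw [← hTn, ← Module.End.mul_apply, ← pow_add] at h
    exact h
  have hcb : ∀ n, c n ≤ a ^ n * (‖(φ : E)‖ * ‖A φ‖) := by
    intro n
    refine (Complex.re_le_norm _).trans ((norm_inner_le_norm _ _).trans ?_)
    rw [← mul_assoc]
    exact mul_le_mul_of_nonneg_right (hbd n) (norm_nonneg _)
  change |_| ≤ a * q
  rw [← hc1]
  by_contra hlt
  push Not at hlt
  have hq0 : 0 < q := by
    rcases hq.eq_or_lt with h | h
    · have := hcsq 1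
      rw [← h, mul_zero] at this
      have h0 : c 1 = 0 := by nlinarith
      rw [h0, ← h] at hlt
      simp at hlt
    · exact h
  let r : ℝ := |c 1| / (a * q)
  have hr : 1 < r := (one_lt_div (by positivity)).2 hlt
  have hpow : ∀ k, (r * a) ^ 2 ^ k * q ≤ |c (2 ^ k)| := by
    intro k
    induction k with
    | zero =>
      simp only [pow_zero, pow_one, r]
      rw [div_mul_eq_mul_div, div_mul_eq_mul_div, div_le_iff₀ (by positivity)]
      exact le_of_eq (by ring)
    | succ k ih =>
      have h1 := hcsq (2 ^ k)
      have h2 : 0 ≤ (r * a) ^ 2 ^ k * q := by positivity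
      have h3 : ((r * a) ^ 2 ^ k * q) ^ 2 ≤ c (2 ^ k + 2 ^ k) * q := by
        refine le_trans ?_ h1
        rw [← sq_abs (c (2 ^ k))]
        exact pow_le_pow_left₀ h2 ih 2
      have h4 : (r * a) ^ 2 ^ (k + 1) * q * q ≤ c (2 ^ k + 2 ^ k) * q := by
        refine le_trans (le_of_eq ?_) h3
        rw [pow_succ 2 k, pow_mul]
        ring
      have h5 := le_of_mul_le_mul_right h4 hq0
      rw [pow_succ 2 k, mul_two] at h5 ⊢
      exact h5.trans (le_abs_self _)
  have hfin : ∀ k, r ^ 2 ^ (k + 1) ≤ ‖(φ : E)‖ * ‖A φ‖ / q := by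
    intro k
    have h1 := hpow (k + 1)
    have h2 : 0 ≤ c (2 ^ (k + 1)) := by
      have := hcsq (2 ^ k)
      rw [pow_succ 2 k, mul_two]
      by_contra hneg
      push Not at hneg
      nlinarith [sq_nonneg (c (2 ^ k))]
    rw [abs_of_nonneg h2] at h1
    have h3 := h1.trans (hcb _)
    rw [le_div_iff₀ hq0]
    rw [mul_pow, mul_comm (r ^ _), mul_assoc] at h3
    exact le_of_mul_le_mul_left h3 (by positivity)
  obtain ⟨N, hN⟩ := pow_unbounded_of_one_lt (‖(φ : E)‖ * ‖A φ‖ / q) hr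
  have h1 : r ^ N ≤ r ^ 2 ^ (N + 1) :=
    pow_le_pow_right₀ hr.le ((Nat.lt_two_pow_self (n := N)).le.trans
      (Nat.pow_le_pow_right (by norm_num) (Nat.le_succ N)))
  exact absurd (h1.trans (hfin N)) (not_le.2 hN)

end Form

/-- Kato–Rellich theorem for a perturbation of relative bound less than one, with form bound. -/
theorem LinearPMap.IsPosSelfAdjoint.katoRellich {A : E →ₗ.[ℂ] E} (hA : A.IsPosSelfAdjoint)
    {Y : A.domain →ₗ[ℂ] E}
    (hs : ∀ φ χ : A.domain, ⟪Y φ, (χ : E)⟫_ℂ = ⟪(φ : E), Y χ⟫_ℂ) {a : ℝ} (ha : 0 < a)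
    (ha1 : a < 1) (hY : ∀ φ, ‖Y φ‖ ≤ a * ‖A φ‖) :
    (perturb A Y).IsPosSelfAdjoint ∧ ∀ φ : A.domain,
      (1 - a) * (⟪(φ : E), A φ⟫_ℂ).re ≤ (⟪(φ : E), perturb A Y φ⟫_ℂ).re := by
  have happ : ∀ φ : A.domain, perturb A Y φ = A φ + Y φ := fun _ => rfl
  have hform : ∀ φ : A.domain,
      (1 - a) * (⟪(φ : E), A φ⟫_ℂ).re ≤ (⟪(φ : E), perturb A Y φ⟫_ℂ).re := by
    intro φ
    rw [happ, inner_add_right, Complex.add_re]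
    have := (abs_le.1 (hA.abs_re_inner_le hs ha hY φ)).1
    linarith
  refine ⟨⟨LinearPMap.isSelfAdjoint_of_surjective hA.dense (fun x y => ?_) fun ψ => ?_, ?_⟩, hform⟩
  · have hsum : ∀ φ χ : A.domain, ⟪A φ + Y φ, (χ : E)⟫_ℂ = ⟪(φ : E), A χ + Y χ⟫_ℂ := fun φ χ => by
      rw [inner_add_left, inner_add_right, hA.symm, hs]
    exact hsum x y
  -- $(A+Y)A^{-1}=1+S$ with $\|S\|\le a<1$ is invertible, so $A+Y$ is surjective.
  · obtain ⟨S, hS, hSb⟩ := hA.exists_comp_inv hY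
    have hSn : ‖-S‖ < 1 := by
      rw [norm_neg]
      exact (S.opNorm_le_bound ha.le hSb).trans_lt ha1
    obtain ⟨V, hV⟩ := (isUnit_one_sub_of_norm_lt_one hSn).exists_right_inv
    have h1 : V ψ + S (V ψ) = ψ := by
      have := congrArg (fun U : E →L[ℂ] E => U ψ) hV
      simpa using this
    refine ⟨⟨invOp A (V ψ), hA.inv_mem _⟩, ?_⟩
    change A ⟨invOp A (V ψ), hA.inv_mem _⟩ + Y ⟨invOp A (V ψ), hA.inv_mem _⟩ = ψ
    rw [hA.apply_inv, ← hS, h1]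
  · obtain ⟨m, hm, hb⟩ := hA.exists_bound
    refine ⟨(1 - a) * m, mul_pos (by linarith) hm, fun φ => ?_⟩
    refine le_trans ?_ (hform φ)
    rw [mul_assoc]
    exact mul_le_mul_of_nonneg_left (hb φ) (by linarith)

/-- Factor $(A+Y)^{-1}=A^{-1}\cdot A(A+Y)^{-1}$; the second factor is bounded by `hb`. -/
theorem LinearPMap.IsPosSelfAdjoint.isCompactOperator_inv_perturb {A : E →ₗ.[ℂ] E}
    (hA : A.IsPosSelfAdjoint) (hc : IsCompactOperator (invOp A)) {Y : A.domain →ₗ[ℂ] E}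
    (hK : (perturb A Y).IsPosSelfAdjoint) {C : ℝ}
    (hb : ∀ φ : A.domain, ‖A φ‖ ≤ C * ‖perturb A Y φ‖) :
    IsCompactOperator (invOp (perturb A Y)) := by
  obtain ⟨S, hS, -⟩ := hK.exists_comp_inv (Y := A.toFun) hb
  have h : invOp (perturb A Y) = (invOp A).comp S := by
    ext ψ
    rw [ContinuousLinearMap.comp_apply, hS]
    exact (hA.inv_apply ⟨_, hK.inv_mem ψ⟩).symm
  rw [h]
  exact hc.comp_clm S

/-- A Hilbert basis of eigenvectors of an unbounded operator. -/
structure LinearPMap.Eigenbasis (A : E →ₗ.[ℂ] E) (ι : Type*) where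
  basis : HilbertBasis ι ℂ E
  val : ι → ℝ
  mem : ∀ i, basis i ∈ A.domain
  apply_basis : ∀ i, A ⟨basis i, mem i⟩ = (val i : ℂ) • basis i

/-- Eigenvectors of the compact operator $A^{-1}$ serve: its eigenvalues $t_i$ are nonzero by
injectivity, and those of $A$ are $t_i^{-1}$. -/
theorem LinearPMap.IsPosSelfAdjoint.exists_eigenbasis {E : Type u} [NormedAddCommGroup E]
    [InnerProductSpace ℂ E] [CompleteSpace E] {A : E →ₗ.[ℂ] E} (hA : A.IsPosSelfAdjoint)
    (hc : IsCompactOperator (invOp A)) : ∃ ι : Type u, Nonempty (A.Eigenbasis ι) := by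
  obtain ⟨ι, b, t, hb⟩ := hc.exists_hilbertBasis_eigenvectors hA.isSelfAdjoint_inv
  have ht : ∀ i, (t i : ℂ) ≠ 0 := by
    intro i h0
    have h1 := hb i
    rw [h0, zero_smul] at h1
    have h2 := hA.apply_inv (b i)
    have h3 : (⟨invOp A (b i), hA.inv_mem (b i)⟩ : A.domain) = 0 := Subtype.ext h1
    rw [h3, LinearPMap.map_zero] at h2
    exact b.ne_zero i h2.symm
  have hbi : ∀ i, b i = (t i : ℂ)⁻¹ • invOp A (b i) := fun i => by
    rw [hb, smul_smul, inv_mul_cancel₀ (ht i), one_smul]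
  have hmem : ∀ i, b i ∈ A.domain := fun i => by
    rw [hbi]; exact A.domain.smul_mem _ (hA.inv_mem _)
  refine ⟨ι, ⟨⟨b, fun i => (t i)⁻¹, hmem, fun i => ?_⟩⟩⟩
  have h1 : (⟨b i, hmem i⟩ : A.domain) = (t i : ℂ)⁻¹ • ⟨invOp A (b i), hA.inv_mem _⟩ :=
    Subtype.ext (hbi i)
  rw [h1, LinearPMap.map_smul, hA.apply_inv, Complex.ofReal_inv]

/-! ### Operators in an eigenbasis -/

namespace LinearPMap.Eigenbasis

variable {A : E →ₗ.[ℂ] E} {ι : Type*} (e : A.Eigenbasis ι)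

/-- The eigenvector as an element of the domain. -/
noncomputable def vec (i : ι) : A.domain := ⟨e.basis i, e.mem i⟩

omit [CompleteSpace E] in
theorem coe_vec (i : ι) : (e.vec i : E) = e.basis i := rfl

omit [CompleteSpace E] in
theorem apply_vec (i : ι) : A (e.vec i) = (e.val i : ℂ) • e.basis i := e.apply_basis i

theorem inner_apply (hA : A.IsPosSelfAdjoint) (i : ι) (φ : A.domain) :
    ⟪e.basis i, A φ⟫_ℂ = e.val i * ⟪e.basis i, (φ : E)⟫_ℂ := by
  rw [← e.coe_vec, ← hA.symm, e.apply_vec, inner_smul_left, Complex.conj_ofReal]; rfl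

omit [CompleteSpace E] in
theorem le_val {m : ℝ} (h : IsBoundedBelowBy A m) (i : ι) : m ≤ e.val i := by
  have h1 := h (e.vec i)
  rw [e.apply_vec, e.coe_vec, inner_smul_right, inner_self_eq_norm_sq_to_K, e.basis.norm_eq_one] at h1
  simpa using h1

theorem val_pos (hA : A.IsPosSelfAdjoint) (i : ι) : 0 < e.val i := by
  obtain ⟨m, hm, h⟩ := hA.exists_bound
  exact hm.trans_le (e.le_val h i)

theorem norm_apply_vec (hA : A.IsPosSelfAdjoint) (i : ι) : ‖A (e.vec i)‖ = e.val i := by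
  rw [e.apply_vec, norm_smul, e.basis.norm_eq_one, mul_one, Complex.norm_real,
    Real.norm_of_nonneg (e.val_pos hA i).le]

theorem invOp_apply (hA : A.IsPosSelfAdjoint) (i : ι) :
    invOp A (e.basis i) = (((e.val i)⁻¹ : ℝ) : ℂ) • e.basis i := by
  have h := hA.inv_apply (e.vec i)
  rw [e.apply_vec, _root_.map_smul, e.coe_vec] at h
  have h0 : (e.val i : ℂ) ≠ 0 := by exact_mod_cast (e.val_pos hA i).ne'
  nth_rewrite 2 [← h]
  rw [smul_smul, Complex.ofReal_inv, inv_mul_cancel₀ h0, one_smul]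

theorem expNeg_apply (hA : A.IsPosSelfAdjoint) (i : ι) :
    expNeg A (e.basis i) = ((Real.exp (-e.val i) : ℝ) : ℂ) • e.basis i := by
  rw [expNeg, cfc_apply_eigenvector hA.isSelfAdjoint_inv (e.basis.ne_zero i) (e.invOp_apply hA i) _
    (expNegInvGlue.contDiff (n := 0)).continuous.continuousOn, expNegInvGlue,
    if_neg (not_le.2 (inv_pos.2 (e.val_pos hA i))), inv_inv]

end LinearPMap.Eigenbasis

end Unbounded

/-! ### Scalar inequalities for the exponential -/

section Inequalities

theorem exp_neg_sub_one_add_nonneg (t : ℝ) : 0 ≤ Real.exp (-t) - 1 + t := by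
  linarith [Real.add_one_le_exp (-t)]

/-- The remainder is at most $t^2$ for $t\ge0$ and at most $t^2e^{-t}$ for $t\le0$; the sum covers
both signs. -/
theorem exp_neg_sub_one_add_le (t : ℝ) :
    Real.exp (-t) - 1 + t ≤ t ^ 2 * (1 + Real.exp (-t)) := by
  have hpos := Real.exp_pos (-t)
  rcases le_total 0 t with h | h
  · have h1 : Real.exp (-t) * (1 + t) ≤ 1 := by
      have h2 := Real.add_one_le_exp t
      have h3 : Real.exp (-t) * Real.exp t = 1 := by rw [← Real.exp_add]; simp
      nlinarith
    have h4 : Real.exp (-t) - 1 + t ≤ t ^ 2 := by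
      by_contra hlt
      push Not at hlt
      nlinarith [mul_nonneg h (sq_nonneg t)]
    nlinarith [mul_nonneg (sq_nonneg t) hpos.le]
  · have h1 : 1 + t ≤ Real.exp t := by linarith [Real.add_one_le_exp t]
    have h3 : Real.exp (-t) * Real.exp t = 1 := by rw [← Real.exp_add]; simp
    have h4 : 1 - t ^ 2 ≤ (1 - t) * Real.exp t := by nlinarith
    have h5 : (1 - t ^ 2) * Real.exp (-t) ≤ 1 - t := by nlinarith
    nlinarith [sq_nonneg t]

theorem exp_neg_taylor_nonneg (x y : ℝ) :
    0 ≤ Real.exp (-y) - Real.exp (-x) + (y - x) * Real.exp (-x) := by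
  have h : Real.exp (-y) = Real.exp (-(y - x)) * Real.exp (-x) := by
    rw [← Real.exp_add]; ring_nf
  rw [h]
  nlinarith [mul_nonneg (exp_neg_sub_one_add_nonneg (y - x)) (Real.exp_pos (-x)).le]

theorem exp_neg_taylor_le (x y : ℝ) :
    Real.exp (-y) - Real.exp (-x) + (y - x) * Real.exp (-x) ≤
      (y - x) ^ 2 * Real.exp (-x) + (y - x) ^ 2 * Real.exp (-y) := by
  have h : Real.exp (-y) = Real.exp (-(y - x)) * Real.exp (-x) := by
    rw [← Real.exp_add]; ring_nf
  rw [h]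
  nlinarith [mul_le_mul_of_nonneg_right (exp_neg_sub_one_add_le (y - x)) (Real.exp_pos (-x)).le]

/-- The quadratic term of $e^{(1-p)x}$ absorbs $x^2$, at the cost of lowering the exponent from $1$
to $p$. -/
theorem sq_mul_exp_neg_le {p x : ℝ} (hp : p < 1) (hx : 0 ≤ x) :
    x ^ 2 * Real.exp (-x) ≤ 2 / (1 - p) ^ 2 * Real.exp (-(p * x)) := by
  have ht : 0 < 1 - p := by linarith
  have h1 := Real.quadratic_le_exp_of_nonneg (mul_nonneg ht.le hx)
  have h2 : Real.exp (-(p * x)) = Real.exp ((1 - p) * x) * Real.exp (-x) := by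
    rw [← Real.exp_add]; ring_nf
  rw [h2, ← mul_assoc]
  refine mul_le_mul_of_nonneg_right ?_ (Real.exp_pos _).le
  rw [div_mul_eq_mul_div, le_div_iff₀ (by positivity)]
  nlinarith [mul_nonneg ht.le hx]

end Inequalities

/-! ### Peierls and Klein inequalities between two eigenbases -/

section Comparison

variable {E : Type*} [NormedAddCommGroup E] [InnerProductSpace ℂ E] [CompleteSpace E]
variable {ι κ : Type*}

omit [CompleteSpace E] in
theorem HilbertBasis.hasSum_mul_norm_inner_sq (e : HilbertBasis ι ℂ E) (f : HilbertBasis κ ℂ E)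
    {d : ι → ℝ} (hd : ∀ i, 0 ≤ d i) (hs : Summable d) :
    HasSum (fun p : ι × κ => d p.1 * ‖⟪f p.2, e p.1⟫_ℂ‖ ^ 2) (∑' i, d i) := by
  have hrow : ∀ i, HasSum (fun j => d i * ‖⟪f j, e i⟫_ℂ‖ ^ 2) (d i) := fun i => by
    simpa [e.norm_eq_one] using (f.hasSum_norm_inner_sq (e i)).mul_left (d i)
  have h : Summable fun p : ι × κ => d p.1 * ‖⟪f p.2, e p.1⟫_ℂ‖ ^ 2 := by
    refine (summable_prod_of_nonneg fun p => mul_nonneg (hd _) (sq_nonneg _)).2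
      ⟨fun i => (hrow i).summable, ?_⟩
    simpa only [fun i => (hrow i).tsum_eq] using hs
  have h1 := h.hasSum.prod_fiberwise hrow
  rw [h1.tsum_eq]
  exact h.hasSum

-- Jensen's inequality for $t\mapsto e^{-st}$ with the probability weights $|\langle
-- x,e_i\rangle|^2$, proved by the tangent line at the mean $m$.
omit [CompleteSpace E] in
theorem HilbertBasis.exp_neg_le_tsum (e : HilbertBasis ι ℂ E) {x : E} (hx : ‖x‖ = 1)
    {l : ι → ℝ} {m s : ℝ} (hm : HasSum (fun i => l i * ‖⟪x, e i⟫_ℂ‖ ^ 2) m)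
    (hs : Summable fun i => Real.exp (-(s * l i)) * ‖⟪x, e i⟫_ℂ‖ ^ 2) :
    Real.exp (-(s * m)) ≤ ∑' i, Real.exp (-(s * l i)) * ‖⟪x, e i⟫_ℂ‖ ^ 2 := by
  have h1 := e.hasSum_norm_inner_sq' x
  rw [hx, one_pow] at h1
  have h2 := (h1.mul_left (Real.exp (-(s * m)) * (1 + s * m))).sub
    (hm.mul_left (Real.exp (-(s * m)) * s))
  have h3 := hasSum_le (fun i => ?_) h2 hs.hasSum
  · refine le_trans (le_of_eq ?_) h3
    ring
  · have h4 := exp_neg_taylor_nonneg (s * m) (s * l i)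
    have h5 := mul_nonneg h4 (sq_nonneg ‖⟪x, e i⟫_ℂ‖)
    nlinarith

/-- Peierls-type comparison of the traces of exponentials under a form inequality. -/
theorem LinearPMap.Eigenbasis.tsum_exp_neg_le {A : E →ₗ.[ℂ] E} {Y : A.domain →ₗ[ℂ] E}
    (hA : A.IsPosSelfAdjoint) (e : A.Eigenbasis ι) (f : (perturb A Y).Eigenbasis κ) {c q : ℝ}
    (hq : 0 ≤ q) (hform : ∀ φ : A.domain,
      c * (⟪(φ : E), A φ⟫_ℂ).re ≤ (⟪(φ : E), perturb A Y φ⟫_ℂ).re)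
    (hs : Summable fun i => Real.exp (-(q * c * e.val i))) :
    Summable (fun j => Real.exp (-(q * f.val j))) ∧
      ∑' j, Real.exp (-(q * f.val j)) ≤ ∑' i, Real.exp (-(q * c * e.val i)) := by
  have h1 := e.basis.hasSum_mul_norm_inner_sq f.basis (fun i => (Real.exp_pos _).le) hs
  have h2 := (Equiv.prodComm κ ι).hasSum_iff.2 h1
  have h2s : Summable fun p : κ × ι =>
      Real.exp (-(q * c * e.val p.2)) * ‖⟪f.basis p.1, e.basis p.2⟫_ℂ‖ ^ 2 := h2.summable
  have h3 := (summable_prod_of_nonneg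
    (fun p : κ × ι => mul_nonneg (Real.exp_pos _).le (sq_nonneg _))).1 h2s
  -- The form inequality at $f_j$ bounds its eigenvalue below by $c\langle f_j,Af_j\rangle$; Jensen
  -- then applies to the weights of $f_j$ in the basis $e$.
  have hle : ∀ j, Real.exp (-(q * f.val j)) ≤
      ∑' i, Real.exp (-(q * c * e.val i)) * ‖⟪f.basis j, e.basis i⟫_ℂ‖ ^ 2 := by
    intro j
    let φ : A.domain := ⟨f.basis j, f.mem j⟩
    have hm : HasSum (fun i => e.val i * ‖⟪f.basis j, e.basis i⟫_ℂ‖ ^ 2)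
        (⟪(φ : E), A φ⟫_ℂ).re := by
      have h4 := Complex.hasSum_re (e.basis.hasSum_inner_mul_inner (φ : E) (A φ))
      refine h4.congr_fun fun i => ?_
      rw [e.inner_apply hA, ← inner_conj_symm (e.basis i) (φ : E), mul_left_comm, Complex.mul_conj',
        ← Complex.ofReal_pow, ← Complex.ofReal_mul, Complex.ofReal_re]
    refine le_trans ?_ (e.basis.exp_neg_le_tsum (f.basis.norm_eq_one j) hm (h3.1 j))
    have h5 := hform φ
    have h6 : perturb A Y φ = (f.val j : ℂ) • f.basis j := f.apply_basis j
    rw [h6, inner_smul_right, inner_self_eq_norm_sq_to_K, f.basis.norm_eq_one] at h5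
    simp only [Complex.coe_algebraMap, Complex.ofReal_one, one_pow, mul_one,
      Complex.ofReal_re] at h5
    rw [Real.exp_le_exp, neg_le_neg_iff, mul_assoc]
    exact mul_le_mul_of_nonneg_left h5 hq
  have hsum := Summable.of_nonneg_of_le (fun j => (Real.exp_pos _).le) hle h3.2
  refine ⟨hsum, (hsum.tsum_le_tsum hle h3.2).trans (le_of_eq ?_)⟩
  rw [← h1.tsum_eq, ← (Equiv.prodComm κ ι).tsum_eq]
  exact (h2s.tsum_prod' h3.1).symm

/-- Klein-type estimate: the first order Taylor remainder of `Tr e^{-A}` is quadratic in the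
relative bound of the perturbation. -/
theorem LinearPMap.Eigenbasis.abs_tsum_exp_neg_sub_le {A : E →ₗ.[ℂ] E} {Y : A.domain →ₗ[ℂ] E}
    (hA : A.IsPosSelfAdjoint) (hK : (perturb A Y).IsPosSelfAdjoint) (e : A.Eigenbasis ι)
    (f : (perturb A Y).Eigenbasis κ) {δ : ℝ} (hYA : ∀ φ, ‖Y φ‖ ≤ δ * ‖A φ‖)
    (hYK : ∀ φ : A.domain, ‖Y φ‖ ≤ δ * ‖perturb A Y φ‖)
    (he : Summable fun i => Real.exp (-e.val i)) (hf : Summable fun j => Real.exp (-f.val j))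
    (he2 : Summable fun i => e.val i ^ 2 * Real.exp (-e.val i))
    (hf2 : Summable fun j => f.val j ^ 2 * Real.exp (-f.val j)) :
    |∑' j, Real.exp (-f.val j) - ∑' i, Real.exp (-e.val i) +
        ∑' i, Real.exp (-e.val i) * (⟪e.basis i, Y (e.vec i)⟫_ℂ).re| ≤
      δ ^ 2 * (∑' i, e.val i ^ 2 * Real.exp (-e.val i) +
        ∑' j, f.val j ^ 2 * Real.exp (-f.val j)) := by
  let P : ι × κ → ℝ := fun p => ‖⟪f.basis p.2, e.basis p.1⟫_ℂ‖ ^ 2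
  have hP : ∀ p, 0 ≤ P p := fun p => sq_nonneg _
  -- $Y$ is the difference of the two operators, so its mixed matrix elements carry the difference
  -- of the eigenvalues.
  have hYe : ∀ i j, ⟪f.basis j, Y (e.vec i)⟫_ℂ =
      ((f.val j - e.val i : ℝ) : ℂ) * ⟪f.basis j, e.basis i⟫_ℂ := by
    intro i j
    have h1 : ⟪f.basis j, A (e.vec i) + Y (e.vec i)⟫_ℂ = f.val j * ⟪f.basis j, e.basis i⟫_ℂ :=
      f.inner_apply hK j (e.vec i)
    rw [inner_add_right, e.apply_vec, inner_smul_right] at h1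
    push_cast
    linear_combination h1
  have hYf : ∀ i j, ⟪e.basis i, Y (f.vec j)⟫_ℂ =
      ((f.val j - e.val i : ℝ) : ℂ) * ⟪e.basis i, f.basis j⟫_ℂ := by
    intro i j
    have h1 : A (f.vec j) + Y (f.vec j) = (f.val j : ℂ) • f.basis j := f.apply_vec j
    have h2 := congrArg (fun z => ⟪e.basis i, z⟫_ℂ) h1
    have h3 : ⟪e.basis i, A (f.vec j)⟫_ℂ = e.val i * ⟪e.basis i, f.basis j⟫_ℂ :=
      e.inner_apply hA i (f.vec j)
    simp only [inner_add_right, inner_smul_right, h3] at h2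
    push_cast
    linear_combination h2
  have ha : HasSum (fun p : ι × κ => Real.exp (-f.val p.2) * P p) (∑' j, Real.exp (-f.val j)) := by
    have h1 := f.basis.hasSum_mul_norm_inner_sq e.basis (fun j => (Real.exp_pos (-f.val j)).le) hf
    have h2 := (Equiv.prodComm ι κ).hasSum_iff.2 h1
    refine h2.congr_fun fun p => ?_
    simp only [P, Function.comp_apply, Equiv.prodComm_apply, Prod.fst_swap, Prod.snd_swap]
    rw [norm_inner_symm]
  have hb : HasSum (fun p : ι × κ => Real.exp (-e.val p.1) * P p) (∑' i, Real.exp (-e.val i)) :=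
    e.basis.hasSum_mul_norm_inner_sq f.basis (fun i => (Real.exp_pos (-e.val i)).le) he
  -- Parseval in $f$ collapses the sum over $j$ to $e^{-\lambda_i}\|Ye_i\|^2$, and
  -- $\|Ye_i\|\le\delta\lambda_i$. The next estimate exchanges the two bases, which is why a bound
  -- of $Y$ relative to the perturbed operator is also needed.
  have hd : Summable (fun p : ι × κ => (f.val p.2 - e.val p.1) ^ 2 * Real.exp (-e.val p.1) * P p) ∧
      ∑' p : ι × κ, (f.val p.2 - e.val p.1) ^ 2 * Real.exp (-e.val p.1) * P p ≤
        δ ^ 2 * ∑' i, e.val i ^ 2 * Real.exp (-e.val i) := by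
    have hrow : ∀ i, HasSum (fun j => (f.val j - e.val i) ^ 2 * Real.exp (-e.val i) * P (i, j))
        (Real.exp (-e.val i) * ‖Y (e.vec i)‖ ^ 2) := fun i => by
      refine ((f.basis.hasSum_norm_inner_sq (Y (e.vec i))).mul_left
        (Real.exp (-e.val i))).congr_fun fun j => ?_
      rw [hYe, norm_mul, mul_pow, Complex.norm_real, Real.norm_eq_abs, sq_abs]
      ring
    have hle : ∀ i, Real.exp (-e.val i) * ‖Y (e.vec i)‖ ^ 2 ≤
        δ ^ 2 * (e.val i ^ 2 * Real.exp (-e.val i)) := fun i => by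
      have h1 := pow_le_pow_left₀ (norm_nonneg _) (hYA (e.vec i)) 2
      rw [e.norm_apply_vec hA] at h1
      nlinarith [Real.exp_pos (-e.val i)]
    have hs1 : Summable fun i => Real.exp (-e.val i) * ‖Y (e.vec i)‖ ^ 2 :=
      Summable.of_nonneg_of_le (fun i => by positivity) hle (he2.mul_left _)
    have hs2 : Summable fun p : ι × κ =>
        (f.val p.2 - e.val p.1) ^ 2 * Real.exp (-e.val p.1) * P p := by
      refine (summable_prod_of_nonneg fun p => ?_).2 ⟨fun i => (hrow i).summable, ?_⟩
      · exact mul_nonneg (by positivity) (hP p)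
      · simpa only [fun i => (hrow i).tsum_eq] using hs1
    refine ⟨hs2, ?_⟩
    rw [hs2.tsum_prod' fun i => (hrow i).summable, ← tsum_mul_left]
    simp only [fun i => (hrow i).tsum_eq]
    exact hs1.tsum_le_tsum hle (he2.mul_left _)
  have hg : Summable (fun p : ι × κ => (f.val p.2 - e.val p.1) ^ 2 * Real.exp (-f.val p.2) * P p) ∧
      ∑' p : ι × κ, (f.val p.2 - e.val p.1) ^ 2 * Real.exp (-f.val p.2) * P p ≤
        δ ^ 2 * ∑' j, f.val j ^ 2 * Real.exp (-f.val j) := by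
    have hrow : ∀ j, HasSum (fun i => (f.val j - e.val i) ^ 2 * Real.exp (-f.val j) * P (i, j))
        (Real.exp (-f.val j) * ‖Y (f.vec j)‖ ^ 2) := fun j => by
      refine ((e.basis.hasSum_norm_inner_sq (Y (f.vec j))).mul_left
        (Real.exp (-f.val j))).congr_fun fun i => ?_
      rw [hYf, norm_mul, mul_pow, Complex.norm_real, Real.norm_eq_abs, sq_abs, norm_inner_symm]
      ring
    have hle : ∀ j, Real.exp (-f.val j) * ‖Y (f.vec j)‖ ^ 2 ≤
        δ ^ 2 * (f.val j ^ 2 * Real.exp (-f.val j)) := fun j => by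
      have h1 := pow_le_pow_left₀ (norm_nonneg _) (hYK (f.vec j)) 2
      have h2 : ‖perturb A Y (f.vec j)‖ = f.val j := f.norm_apply_vec hK j
      rw [h2] at h1
      nlinarith [Real.exp_pos (-f.val j)]
    have hs1 : Summable fun j => Real.exp (-f.val j) * ‖Y (f.vec j)‖ ^ 2 :=
      Summable.of_nonneg_of_le (fun i => by positivity) hle (hf2.mul_left _)
    have hs2 : Summable fun p : κ × ι =>
        (f.val p.1 - e.val p.2) ^ 2 * Real.exp (-f.val p.1) * P (p.2, p.1) := by
      refine (summable_prod_of_nonneg fun p => ?_).2 ⟨fun j => (hrow j).summable, ?_⟩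
      · exact mul_nonneg (by positivity) (hP _)
      · simpa only [fun i => (hrow i).tsum_eq] using hs1
    refine ⟨(Equiv.prodComm ι κ).summable_iff.2 hs2, ?_⟩
    rw [← (Equiv.prodComm κ ι).tsum_eq]
    refine le_trans (le_of_eq (hs2.tsum_prod' fun j => (hrow j).summable)) ?_
    rw [← tsum_mul_left]
    simp only [fun i => (hrow i).tsum_eq]
    exact hs1.tsum_le_tsum hle (hf2.mul_left _)
  have hc : HasSum (fun p : ι × κ => (f.val p.2 - e.val p.1) * Real.exp (-e.val p.1) * P p)
      (∑' i, Real.exp (-e.val i) * (⟪e.basis i, Y (e.vec i)⟫_ℂ).re) := by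
    have hrow : ∀ i, HasSum (fun j => (f.val j - e.val i) * Real.exp (-e.val i) * P (i, j))
        (Real.exp (-e.val i) * (⟪e.basis i, Y (e.vec i)⟫_ℂ).re) := fun i => by
      refine ((Complex.hasSum_re (f.basis.hasSum_inner_mul_inner (e.basis i)
        (Y (e.vec i)))).mul_left (Real.exp (-e.val i))).congr_fun fun j => ?_
      rw [hYe, ← inner_conj_symm (e.basis i), mul_left_comm, Complex.conj_mul',
        ← Complex.ofReal_pow, ← Complex.ofReal_mul, Complex.ofReal_re]
      simp only [P]
      ring
    -- Absolute convergence follows from $|t|\le1+t^2$ and the two sums already controlled.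
    have hs : Summable fun p : ι × κ => (f.val p.2 - e.val p.1) * Real.exp (-e.val p.1) * P p := by
      refine Summable.of_norm_bounded (hb.summable.add hd.1) fun p => ?_
      rw [norm_mul, norm_mul, Real.norm_of_nonneg (hP p), Real.norm_of_nonneg (Real.exp_pos _).le,
        Real.norm_eq_abs]
      have h1 : |f.val p.2 - e.val p.1| ≤ 1 + (f.val p.2 - e.val p.1) ^ 2 := by
        rw [← sq_abs]
        nlinarith [sq_nonneg (|f.val p.2 - e.val p.1| - 1), abs_nonneg (f.val p.2 - e.val p.1)]
      have h2 := mul_le_mul_of_nonneg_right h1 (mul_nonneg (Real.exp_pos (-e.val p.1)).le (hP p))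
      linarith
    have h1 := hs.hasSum.prod_fiberwise hrow
    rw [h1.tsum_eq]
    exact hs.hasSum
  have hmain := (ha.sub hb).add hc
  have hub := hd.1.hasSum.add hg.1.hasSum
  rw [abs_le]
  constructor
  · have h0 := hmain.nonneg fun p => by
      have := mul_nonneg (exp_neg_taylor_nonneg (e.val p.1) (f.val p.2)) (hP p)
      linarith
    have h1 : 0 ≤ δ ^ 2 * (∑' i, e.val i ^ 2 * Real.exp (-e.val i) +
        ∑' j, f.val j ^ 2 * Real.exp (-f.val j)) :=
      mul_nonneg (sq_nonneg _) (add_nonneg (tsum_nonneg fun i => by positivity)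
        (tsum_nonneg fun j => by positivity))
    linarith
  · have h2 := hasSum_le (fun p => by
      have := mul_le_mul_of_nonneg_right (exp_neg_taylor_le (e.val p.1) (f.val p.2)) (hP p)
      linarith) hmain hub
    linarith [hd.2, hg.2]

end Comparison

/-! ### Gibbs states, Schatten classes and means -/

section Traces

variable {E : Type*} [NormedAddCommGroup E] [InnerProductSpace ℂ E] [CompleteSpace E]
variable {κ : Type*}

theorem star_mul_self_apply_of_diagonal {f : HilbertBasis κ ℂ E} {T : E →L[ℂ] E}
    (hT : IsSelfAdjoint T) {d : κ → ℝ} (h : ∀ j, T (f j) = (d j : ℂ) • f j) (j : κ) :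
    (star T * T) (f j) = ((d j ^ 2 : ℝ) : ℂ) • f j := by
  rw [hT.star_eq]
  change T (T (f j)) = _
  rw [h, map_smul, h, smul_smul, ← Complex.ofReal_mul, sq]

theorem isSchatten_iff_of_diagonal (f : HilbertBasis κ ℂ E) {T : E →L[ℂ] E}
    (hT : IsSelfAdjoint T) {d : κ → ℝ} (h : ∀ j, T (f j) = (d j : ℂ) • f j) {p : ℝ} (hp : 0 < p) :
    IsSchatten p T ↔ IsCompactOperator T ∧ Summable fun j => |d j| ^ p := by
  have h1 : ∀ j, (CFC.abs T ^ p : E →L[ℂ] E) (f j) = ((|d j| ^ p : ℝ) : ℂ) • f j := by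
    intro j
    have hnn : 0 ≤ CFC.abs T := CFC.abs_nonneg T
    rw [CFC.rpow_eq_cfc_real hnn]
    exact cfc_apply_eigenvector hnn.isSelfAdjoint (f.ne_zero j)
      (abs_apply_eigenvector (f.ne_zero j) (star_mul_self_apply_of_diagonal hT h j)) _
      (Real.continuous_rpow_const hp.le).continuousOn
  rw [IsSchatten, (onBasis E).summable_re_inner_diagonal_iff f
    (fun j => Real.rpow_nonneg (abs_nonneg _) _) h1]

theorem expNegInvGlue_continuous_inv_pow_mul (n : ℕ) :
    Continuous fun x : ℝ => x⁻¹ ^ n * expNegInvGlue x := by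
  simpa using expNegInvGlue.continuous_polynomial_eval_inv_mul (Polynomial.X ^ n)

variable {A : E →ₗ.[ℂ] E}

/-- `e^{-A} = G A⁻¹` with `G = A e^{-A}` compact when `A⁻¹` is. -/
theorem LinearPMap.IsPosSelfAdjoint.exists_expNeg_eq (hA : A.IsPosSelfAdjoint)
    (hc : IsCompactOperator (invOp A)) :
    ∃ G : E →L[ℂ] E, IsCompactOperator G ∧ expNeg A = G * invOp A := by
  have hR := hA.isSelfAdjoint_inv
  -- That is, $A^{n+1}e^{-A}\cdot A^{-1}=A^ne^{-A}$. The case $n=0$ factors $e^{-A}$, and $n=1$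
  -- shows that $G=Ae^{-A}$ is itself compact. At $x=0$ both functions vanish.
  have hstep : ∀ n : ℕ, cfc (fun x : ℝ => x⁻¹ ^ (n + 1) * expNegInvGlue x) (invOp A) * invOp A =
      cfc (fun x : ℝ => x⁻¹ ^ n * expNegInvGlue x) (invOp A) := by
    intro n
    nth_rewrite 2 [← cfc_id' ℝ (invOp A) hR]
    rw [← cfc_mul (fun x : ℝ => x⁻¹ ^ (n + 1) * expNegInvGlue x) (fun x => x) (invOp A)
      (expNegInvGlue_continuous_inv_pow_mul _).continuousOn continuousOn_id]
    congr 1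
    ext x
    rcases eq_or_ne x 0 with rfl | hx
    · simp [expNegInvGlue.zero]
    · rw [pow_succ, mul_right_comm, mul_assoc (x⁻¹ ^ n), inv_mul_cancel₀ hx, mul_one]
  refine ⟨cfc (fun x : ℝ => x⁻¹ ^ 1 * expNegInvGlue x) (invOp A), ?_, ?_⟩
  · rw [← hstep 1]
    exact hc.clm_comp _
  · rw [hstep 0]
    simp [expNeg]

theorem LinearPMap.IsPosSelfAdjoint.isCompactOperator_expNeg (hA : A.IsPosSelfAdjoint)
    (hc : IsCompactOperator (invOp A)) : IsCompactOperator (expNeg A) := by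
  obtain ⟨G, hG, h⟩ := hA.exists_expNeg_eq hc
  rw [h]
  exact hG.comp_clm _

theorem expNeg_nonneg (A : E →ₗ.[ℂ] E) : 0 ≤ expNeg A :=
  cfc_nonneg fun x _ => expNegInvGlue.nonneg x

theorem expNeg_isSelfAdjoint (A : E →ₗ.[ℂ] E) : IsSelfAdjoint (expNeg A) :=
  (expNeg_nonneg A).isSelfAdjoint

theorem gibbsState_isSelfAdjoint (A : E →ₗ.[ℂ] E) : IsSelfAdjoint (gibbsState A) := by
  rw [gibbsState, ← Complex.ofReal_inv, Complex.coe_smul]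
  exact (IsSelfAdjoint.all _).smul (expNeg_isSelfAdjoint A)

namespace LinearPMap.Eigenbasis

variable (f : A.Eigenbasis κ)

theorem gibbsState_apply (hA : A.IsPosSelfAdjoint) (j : κ) :
    gibbsState A (f.basis j) =
      (((partitionFunction A)⁻¹ * Real.exp (-f.val j) : ℝ) : ℂ) • f.basis j := by
  change ((partitionFunction A : ℂ)⁻¹) • expNeg A (f.basis j) = _
  rw [f.expNeg_apply hA, smul_smul]
  push_cast
  rfl

theorem partitionFunction_eq (hA : A.IsPosSelfAdjoint)
    (hs : Summable fun j => Real.exp (-f.val j)) :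
    partitionFunction A = ∑' j, Real.exp (-f.val j) := by
  rw [partitionFunction, opTrace_of_diagonal f.basis (fun j => (Real.exp_pos _).le)
    (f.expNeg_apply hA) (expNeg_isSelfAdjoint A) hs, Complex.ofReal_re]

omit [CompleteSpace E] in
include f in
theorem nonempty_index [Nontrivial E] : Nonempty κ := by
  by_contra h
  rw [not_nonempty_iff] at h
  obtain ⟨x, hx⟩ := exists_ne (0 : E)
  have h1 := (f.basis.hasSum_norm_inner_sq x).unique hasSum_empty
  exact hx (by simpa using h1)

theorem partitionFunction_pos [Nontrivial E] (hA : A.IsPosSelfAdjoint)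
    (hs : Summable fun j => Real.exp (-f.val j)) : 0 < partitionFunction A := by
  rw [f.partitionFunction_eq hA hs]
  obtain ⟨j⟩ := f.nonempty_index
  exact hs.tsum_pos (fun j => (Real.exp_pos _).le) j (Real.exp_pos _)

theorem gibbsState_mem_stateManifold [Nontrivial E] (hA : A.IsPosSelfAdjoint)
    (hc : IsCompactOperator (invOp A)) (hs : Summable fun j => Real.exp (-f.val j)) {p : ℝ}
    (hp0 : 0 < p) (hp1 : p < 1) (hsp : Summable fun j => Real.exp (-(p * f.val j))) :
    gibbsState A ∈ stateManifold E := by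
  have hZ := f.partitionFunction_pos hA hs
  have hsa := gibbsState_isSelfAdjoint A
  have hd0 : ∀ j, 0 ≤ (partitionFunction A)⁻¹ * Real.exp (-f.val j) := fun j => by positivity
  have hsd : Summable fun j => (partitionFunction A)⁻¹ * Real.exp (-f.val j) := hs.mul_left _
  refine ⟨⟨?_, ?_, ?_⟩, p, hp0, hp1, ?_⟩
  · rw [gibbsState, ← Complex.ofReal_inv, Complex.coe_smul]
    exact smul_nonneg (inv_pos.2 hZ).le (expNeg_nonneg A)
  · rw [isTraceClass_iff_of_diagonal f.basis
      (star_mul_self_apply_of_diagonal hsa (f.gibbsState_apply hA))]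
    exact hsd.congr fun j => (abs_of_nonneg (hd0 j)).symm
  · rw [opTrace_of_diagonal f.basis hd0 (f.gibbsState_apply hA) hsa hsd, tsum_mul_left,
      ← f.partitionFunction_eq hA hs, inv_mul_cancel₀ hZ.ne', Complex.ofReal_one]
  · rw [isSchatten_iff_of_diagonal f.basis hsa (f.gibbsState_apply hA) hp0]
    refine ⟨(hA.isCompactOperator_expNeg hc).smul _, (hsp.mul_left
      ((partitionFunction A)⁻¹ ^ p)).congr fun j => ?_⟩
    rw [abs_of_nonneg (hd0 j), Real.mul_rpow (inv_pos.2 hZ).le (Real.exp_pos _).le,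
      ← Real.exp_mul]
    ring_nf

/-- The mean of an `ω`-direction in the Gibbs state exists and is computed in an eigenbasis. -/
theorem hasMean [Nontrivial E] (hA : A.IsPosSelfAdjoint) (hc : IsCompactOperator (invOp A))
    (hs : Summable fun j => Real.exp (-f.val j))
    (hs2 : Summable fun j => f.val j ^ 2 * Real.exp (-f.val j))
    {Y : A.domain →ₗ[ℂ] E} (hY : Y ∈ omegaDirections A) :
    HasMean A Y (((partitionFunction A)⁻¹ *
      ∑' j, Real.exp (-f.val j) * (⟪f.basis j, Y (f.vec j)⟫_ℂ).re : ℝ) : ℂ) := by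
  have hZ := f.partitionFunction_pos hA hs
  have hYb : ∀ φ : A.domain, ‖Y φ‖ ≤ ‖(⟨Y, hY⟩ : omegaDirections A)‖ * ‖A φ‖ :=
    hA.norm_omega_apply_le ⟨Y, hY⟩
  obtain ⟨S, hS, -⟩ := hA.exists_comp_inv hYb
  obtain ⟨G, hG, hGR⟩ := hA.exists_expNeg_eq hc
  have hSadj : ∀ φ : A.domain, ContinuousLinearMap.adjoint S φ = invOp A (Y φ) := by
    intro φ
    refine ext_inner_right ℂ fun ψ => ?_
    rw [ContinuousLinearMap.adjoint_inner_left, hS, ← hY.1, hA.inner_inv]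
  -- $S=YA^{-1}$ is bounded and $S^*$ extends $A^{-1}Y$, so $Z^{-1}GS^*$ extends $Z^{-1}e^{-A}Y$.
  let T : E →L[ℂ] E := ((partitionFunction A : ℂ)⁻¹) • (G * ContinuousLinearMap.adjoint S)
  have hTφ : ∀ φ : A.domain, T φ = gibbsState A (Y φ) := by
    intro φ
    rw [gibbsState, hGR]
    change ((partitionFunction A : ℂ)⁻¹) • G (ContinuousLinearMap.adjoint S φ) = _
    rw [hSadj]
    rfl
  have hTc : IsCompactOperator T :=
    (hG.comp_clm (ContinuousLinearMap.adjoint S)).smul ((partitionFunction A : ℂ)⁻¹)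
  let w : κ → ℝ := fun j => (partitionFunction A)⁻¹ * Real.exp (-f.val j)
  have hw : ∀ j, 0 ≤ w j := fun j => by positivity
  -- That is, $T^*f_j=w_jYf_j$, the input of the trace-class criterion; checked on the domain and
  -- extended by density.
  have hTw : ∀ j x, ⟪f.basis j, T x⟫_ℂ = w j * ⟪Y (f.vec j), x⟫_ℂ := by
    intro j
    have h1 : Set.EqOn (fun x => ⟪f.basis j, T x⟫_ℂ) (fun x => w j * ⟪Y (f.vec j), x⟫_ℂ)
        (A.domain : Set E) := by
      intro x hx
      change ⟪f.basis j, T x⟫_ℂ = w j * ⟪Y (f.vec j), ((⟨x, hx⟩ : A.domain) : E)⟫_ℂ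
      have h2 : T x = gibbsState A (Y ⟨x, hx⟩) := hTφ ⟨x, hx⟩
      have h3 : ⟪gibbsState A (f.basis j), Y ⟨x, hx⟩⟫_ℂ =
          ⟪f.basis j, gibbsState A (Y ⟨x, hx⟩)⟫_ℂ :=
        (gibbsState_isSelfAdjoint A).isSymmetric _ _
      rw [h2, ← h3, f.gibbsState_apply hA, inner_smul_left, Complex.conj_ofReal, hY.1]
      rfl
    have h4 := Continuous.ext_on hA.dense (by fun_prop) (by fun_prop) h1
    exact fun x => congrFun h4 x
  have hsum : Summable fun j => w j * (1 + ‖Y (f.vec j)‖ ^ 2) := by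
    refine Summable.of_nonneg_of_le (fun j => mul_nonneg (hw j) (by positivity)) (fun j => ?_)
      ((hs.add (hs2.mul_left (‖(⟨Y, hY⟩ : omegaDirections A)‖ ^ 2))).mul_left
        (partitionFunction A)⁻¹)
    have h1 := pow_le_pow_left₀ (norm_nonneg _) (hYb (f.vec j)) 2
    rw [f.norm_apply_vec hA, mul_pow] at h1
    have h2 := mul_le_mul_of_nonneg_left h1 (hw j)
    simp only [w] at h2 ⊢
    linarith
  refine ⟨T, hTφ, isTraceClass_of_adjoint f.basis hTc hw hTw hsum, ?_⟩
  rw [opTrace, ((onBasis E).hasSum_inner_apply_of_adjoint f.basis hw hTw hsum).tsum_eq,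
    ← tsum_mul_left, Complex.ofReal_tsum]
  refine tsum_congr fun j => ?_
  have h1 : ⟪Y (f.vec j), f.basis j⟫_ℂ = ⟪f.basis j, Y (f.vec j)⟫_ℂ := hY.1 (f.vec j) (f.vec j)
  have h2 : (((⟪f.basis j, Y (f.vec j)⟫_ℂ).re : ℝ) : ℂ) = ⟪f.basis j, Y (f.vec j)⟫_ℂ := by
    rw [← Complex.conj_eq_iff_re, inner_conj_symm, h1]
  rw [h1, ← mul_assoc, Complex.ofReal_mul (_ * _), h2]

end LinearPMap.Eigenbasis

end Traces

/-! ### From quadratic remainders to Fréchet derivatives of logarithms -/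

section Calculus

theorem hasFDerivAt_of_quadratic_bound {V : Type*} [SeminormedAddCommGroup V] [NormedSpace ℝ V]
    {F : V → ℝ} {L : V →L[ℝ] ℝ} {x : V} {C δ : ℝ} (hδ : 0 < δ)
    (h : ∀ y, ‖y‖ ≤ δ → |F (x + y) - F x - L y| ≤ C * ‖y‖ ^ 2) : HasFDerivAt F L x := by
  rw [hasFDerivAt_iff_isLittleO, Asymptotics.isLittleO_iff]
  intro c hc
  have hpos : 0 < min δ (c / (|C| + 1)) := lt_min hδ (by positivity)
  filter_upwards [Metric.closedBall_mem_nhds x hpos] with z hz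
  rw [mem_closedBall_iff_norm] at hz
  have h1 := h (z - x) (hz.trans (min_le_left _ _))
  rw [add_sub_cancel] at h1
  refine h1.trans ?_
  have h2 := hz.trans (min_le_right _ _)
  rw [le_div_iff₀ (by positivity)] at h2
  nlinarith [norm_nonneg (z - x), le_abs_self C,
    mul_le_mul_of_nonneg_right h2 (norm_nonneg (z - x)),
    mul_le_mul_of_nonneg_right (le_abs_self C) (sq_nonneg ‖z - x‖)]

theorem abs_log_one_add_sub_le {u : ℝ} (hu : |u| ≤ 1 / 2) : |Real.log (1 + u) - u| ≤ 2 * u ^ 2 := by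
  obtain ⟨h1, h2⟩ := abs_le.1 hu
  have hpos : 0 < 1 + u := by linarith
  have h3 := Real.log_le_sub_one_of_pos hpos
  have h4 := Real.one_sub_inv_le_log_of_pos hpos
  have h5 : u - 2 * u ^ 2 ≤ 1 - (1 + u)⁻¹ := by
    have h6 : 1 - (1 + u)⁻¹ = u / (1 + u) := by field_simp; ring
    rw [h6, le_div_iff₀ hpos]
    nlinarith [mul_nonneg (sq_nonneg u) (by linarith : 0 ≤ 1 + 2 * u)]
  rw [abs_le]
  constructor <;> nlinarith [sq_nonneg u]

/-- With $v=(Z'-Z)/Z$ the difference of logarithms is $\log(1+v)$. Here $v-l=O(y^2)$, hence $v=O(y)$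
as $y\le1$, and $\log(1+v)-v=O(v^2)$. -/
theorem abs_log_sub_log_sub_le {Z Z' l y D Λ : ℝ} (hZ : 0 < Z) (hZ' : 0 < Z') (hy : 0 ≤ y)
    (hy1 : y ≤ 1) (hD : 0 ≤ D) (h : |Z' - Z - Z * l| ≤ D * y ^ 2) (hl : |l| ≤ Λ * y)
    (hs : (Λ + D / Z) * y ≤ 1 / 2) :
    |Real.log Z' - Real.log Z - l| ≤ (2 * (Λ + D / Z) ^ 2 + D / Z) * y ^ 2 := by
  let v : ℝ := (Z' - Z) / Z
  have hv1 : |v - l| ≤ D / Z * y ^ 2 := by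
    have h1 : v - l = (Z' - Z - Z * l) / Z := by
      simp only [v]; field_simp
    rw [h1, abs_div, abs_of_pos hZ, div_mul_eq_mul_div]
    exact div_le_div_of_nonneg_right h hZ.le
  have hv2 : |v| ≤ (Λ + D / Z) * y := by
    have h1 : |v| ≤ |v - l| + |l| := by
      simpa using abs_add_le (v - l) l
    have h2 : D / Z * y ^ 2 ≤ D / Z * y :=
      mul_le_mul_of_nonneg_left (by nlinarith) (by positivity)
    linarith
  have h3 := abs_log_one_add_sub_le (hv2.trans hs)
  have h4 : Real.log (1 + v) = Real.log Z' - Real.log Z := by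
    rw [← Real.log_div hZ'.ne' hZ.ne']
    congr 1
    simp only [v]
    field_simp
    ring
  rw [h4] at h3
  have h5 : v ^ 2 ≤ (Λ + D / Z) ^ 2 * y ^ 2 := by
    rw [← mul_pow, ← sq_abs]
    exact pow_le_pow_left₀ (abs_nonneg _) hv2 2
  have h6 : |Real.log Z' - Real.log Z - l| ≤ |Real.log Z' - Real.log Z - v| + |v - l| := by
    simpa using abs_add_le (Real.log Z' - Real.log Z - v) (v - l)
  linarith

theorem exists_log_quadratic_bound {V : Type*} [SeminormedAddCommGroup V] [NormedSpace ℝ V]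
    {F : V → ℝ} {L : V →L[ℝ] ℝ} {Z D r : ℝ} (hZ : 0 < Z) (hD : 0 ≤ D) (hr : 0 < r)
    (h : ∀ y, ‖y‖ ≤ r → 0 < F y ∧ |F y - Z - Z * L y| ≤ D * ‖y‖ ^ 2) :
    ∃ C δ : ℝ, 0 < δ ∧ ∀ y, ‖y‖ ≤ δ → |Real.log (F y) - Real.log Z - L y| ≤ C * ‖y‖ ^ 2 := by
  let Λ : ℝ := ‖L‖ + D / Z
  have hΛ : 0 ≤ Λ := add_nonneg (norm_nonneg _) (div_nonneg hD hZ.le)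
  refine ⟨2 * Λ ^ 2 + D / Z, min (min 1 r) (1 / (2 * (Λ + 1))),
    lt_min (lt_min one_pos hr) (by positivity), fun y hy => ?_⟩
  have hy1 : ‖y‖ ≤ 1 := hy.trans ((min_le_left _ _).trans (min_le_left _ _))
  obtain ⟨hpos, hest⟩ := h y (hy.trans ((min_le_left _ _).trans (min_le_right _ _)))
  have hyΛ : Λ * ‖y‖ ≤ 1 / 2 := by
    have h1 := hy.trans (min_le_right _ _)
    rw [le_div_iff₀ (by positivity)] at h1
    linarith [norm_nonneg y]
  exact abs_log_sub_log_sub_le hZ hpos (norm_nonneg y) hy1 hD hest (L.le_opNorm y) hyΛ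

end Calculus

/-! ### Perturbation by an $\omega$-direction -/

section Perturbation

variable {E : Type u} [NormedAddCommGroup E] [InnerProductSpace ℂ E] [CompleteSpace E]
variable {ι κ : Type*}

theorem nontrivial_of_isDensityOperator {ρ : E →L[ℂ] E} (h : IsDensityOperator ρ) :
    Nontrivial E := by
  by_contra hE
  rw [not_nontrivial_iff_subsingleton] at hE
  have h1 : opTrace ρ = 0 := by
    rw [opTrace]
    refine (tsum_congr fun i => ?_).trans tsum_zero
    rw [Subsingleton.elim (ρ _) 0, inner_zero_right]
  exact one_ne_zero (h.2.2.symm.trans h1)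

/-- If $Z=0$, the convention $0^{-1}=0$ makes the Gibbs state zero, whose trace is not one. -/
theorem partitionFunction_ne_zero {A : E →ₗ.[ℂ] E} (h : IsDensityOperator (gibbsState A)) :
    partitionFunction A ≠ 0 := by
  intro h0
  have h1 : opTrace (gibbsState A) = 0 := by
    rw [opTrace, gibbsState, h0, Complex.ofReal_zero, inv_zero]
    refine (tsum_congr fun i => ?_).trans tsum_zero
    rw [zero_smul]
    exact inner_zero_right _
  exact one_ne_zero (h.2.2.symm.trans h1)

theorem LinearPMap.IsPosSelfAdjoint.isCompactOperator_inv {A : E →ₗ.[ℂ] E}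
    (hA : A.IsPosSelfAdjoint) (hZ : partitionFunction A ≠ 0)
    (h : IsCompactOperator (gibbsState A)) : IsCompactOperator (invOp A) := by
  refine isCompactOperator_of_cfc hA.inv_nonneg (expNegInvGlue.contDiff (n := 0)).continuous
    (fun x hx => expNegInvGlue.pos_of_pos hx) ?_
  have h1 : (partitionFunction A : ℂ) • gibbsState A = expNeg A := by
    rw [gibbsState, smul_smul, mul_inv_cancel₀ (by exact_mod_cast hZ), one_smul]
  have h2 : IsCompactOperator (((partitionFunction A : ℂ) • gibbsState A : E →L[ℂ] E)) :=
    h.smul (partitionFunction A : ℂ)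
  rw [h1] at h2
  exact h2

theorem LinearPMap.Eigenbasis.summable_of_isSchatten {A : E →ₗ.[ℂ] E} (e : A.Eigenbasis ι)
    (hA : A.IsPosSelfAdjoint) (hZ : partitionFunction A ≠ 0) {p : ℝ} (hp : 0 < p)
    (h : IsSchatten p (gibbsState A)) : Summable fun i => Real.exp (-(p * e.val i)) := by
  have h1 := ((isSchatten_iff_of_diagonal e.basis (gibbsState_isSelfAdjoint A)
    (e.gibbsState_apply hA) hp).1 h).2
  have h2 : |(partitionFunction A)⁻¹| ^ p ≠ 0 :=
    (Real.rpow_pos_of_pos (abs_pos.2 (inv_ne_zero hZ)) p).ne'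
  refine (summable_mul_left_iff h2).1 (h1.congr fun i => ?_)
  rw [abs_mul, abs_of_pos (Real.exp_pos _), Real.mul_rpow (abs_nonneg _) (Real.exp_pos _).le,
    ← Real.exp_mul]
  ring_nf

omit [CompleteSpace E] in
theorem perturb_perturb (A : E →ₗ.[ℂ] E) (X Y : A.domain →ₗ[ℂ] E) :
    perturb (perturb A X) Y = perturb A (X + Y) := by
  change (⟨A.domain, A.toFun + X + Y⟩ : E →ₗ.[ℂ] E) = ⟨A.domain, A.toFun + (X + Y)⟩
  rw [add_assoc]

/-! ### Comparison of $A$ and $A+X$, uniformly in $\|X\|_\omega\le a$ -/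

section Direction

variable {A : E →ₗ.[ℂ] E} (hA : A.IsPosSelfAdjoint) {a : ℝ} {X : omegaDirections A}
include hA

theorem norm_omega_apply_le_of_le (hX : ‖X‖ ≤ a) (φ : A.domain) : ‖X.1 φ‖ ≤ a * ‖A φ‖ :=
  (hA.norm_omega_apply_le X φ).trans (mul_le_mul_of_nonneg_right hX (norm_nonneg _))

theorem norm_perturb_apply_le (hX : ‖X‖ ≤ a) (φ : A.domain) :
    ‖perturb A X.1 φ‖ ≤ (1 + a) * ‖A φ‖ := by
  have h1 := norm_omega_apply_le_of_le hA hX φ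
  have h2 : ‖perturb A X.1 φ‖ ≤ ‖A φ‖ + ‖X.1 φ‖ := norm_add_le (A φ) (X.1 φ)
  linarith

theorem norm_apply_le_perturb (ha1 : a < 1) (hX : ‖X‖ ≤ a) (φ : A.domain) :
    ‖A φ‖ ≤ (1 - a)⁻¹ * ‖perturb A X.1 φ‖ := by
  have h1 := norm_omega_apply_le_of_le hA hX φ
  have h2 : ‖A φ‖ ≤ ‖perturb A X.1 φ‖ + ‖X.1 φ‖ := by
    have h3 : ‖A φ‖ = ‖perturb A X.1 φ - X.1 φ‖ := by
      change ‖A φ‖ = ‖A φ + X.1 φ - X.1 φ‖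
      rw [add_sub_cancel_right]
    rw [h3]
    exact norm_sub_le _ _
  rw [inv_mul_eq_div, le_div_iff₀ (by linarith)]
  linarith

variable (ha : 0 < a) (ha1 : a < 1) (hX : ‖X‖ ≤ a)
include ha ha1 hX

theorem isPosSelfAdjoint_perturb : (perturb A X.1).IsPosSelfAdjoint :=
  (hA.katoRellich X.2.1 ha ha1 (norm_omega_apply_le_of_le hA hX)).1

theorem isCompactOperator_invOp_perturb (hc : IsCompactOperator (invOp A)) :
    IsCompactOperator (invOp (perturb A X.1)) :=
  hA.isCompactOperator_inv_perturb hc (isPosSelfAdjoint_perturb hA ha ha1 hX)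
    (norm_apply_le_perturb hA ha1 hX)

theorem omegaDirections_perturb : omegaDirections (perturb A X.1) = omegaDirections A := by
  have hK := isPosSelfAdjoint_perturb hA ha ha1 hX
  have key : ∀ Y : A.domain →ₗ[ℂ] E, Y ∈ omegaDirections (perturb A X.1) ↔
      Y ∈ omegaDirections A := by
    intro Y
    refine (hK.mem_omegaDirections_iff Y).trans (Iff.trans ?_ (hA.mem_omegaDirections_iff Y).symm)
    refine and_congr Iff.rfl ⟨fun ⟨C, hC⟩ => ⟨|C| * (1 + a), fun φ => ?_⟩,
      fun ⟨C, hC⟩ => ⟨|C| * (1 - a)⁻¹, fun φ => ?_⟩⟩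
    · refine (hC φ).trans ?_
      rw [mul_assoc]
      exact mul_le_mul (le_abs_self C) (norm_perturb_apply_le hA hX φ) (norm_nonneg _)
        (abs_nonneg C)
    · refine (hC φ).trans ?_
      rw [mul_assoc]
      exact mul_le_mul (le_abs_self C) (norm_apply_le_perturb hA ha1 hX φ) (norm_nonneg _)
        (abs_nonneg C)
  exact Submodule.ext key

/-- The identity map between the spaces of `ω`-directions at `A` and at `A + X`. -/
theorem exists_omega_inclusion : ∃ J : omegaDirections A →L[ℝ] omegaDirections (perturb A X.1),
    (∀ Y, (J Y).1 = Y.1) ∧ ∀ Y, ‖J Y‖ ≤ (1 - a)⁻¹ * ‖Y‖ := by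
  have hK := isPosSelfAdjoint_perturb hA ha ha1 hX
  have hle : omegaDirections A ≤ omegaDirections (perturb A X.1) :=
    (omegaDirections_perturb hA ha ha1 hX).ge
  let J : omegaDirections A →ₗ[ℝ] omegaDirections (perturb A X.1) :=
    { toFun := fun Y => ⟨Y.1, hle Y.2⟩
      map_add' := fun _ _ => rfl
      map_smul' := fun _ _ => rfl }
  have hb : ∀ Y, ‖J Y‖ ≤ (1 - a)⁻¹ * ‖Y‖ := by
    intro Y
    have h0 : 0 ≤ (1 - a)⁻¹ := inv_nonneg.2 (by linarith)
    refine hK.omega_norm_le _ (mul_nonneg h0 (norm_nonneg Y)) fun φ => ?_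
    refine (hA.norm_omega_apply_le Y φ).trans ?_
    have h1 := mul_le_mul_of_nonneg_left (norm_apply_le_perturb hA ha1 hX φ) (norm_nonneg Y)
    linarith
  exact ⟨J.mkContinuous _ hb, fun _ => rfl, hb⟩

theorem exists_omega_lift (Y : omegaDirections (perturb A X.1)) :
    ∃ Y' : omegaDirections A, Y'.1 = Y.1 ∧ ‖Y'‖ ≤ (1 + a) * ‖Y‖ := by
  have hK := isPosSelfAdjoint_perturb hA ha ha1 hX
  have hmem : Y.1 ∈ omegaDirections A := (omegaDirections_perturb hA ha ha1 hX).le Y.2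
  refine ⟨⟨Y.1, hmem⟩, rfl, hA.omega_norm_le _ (by positivity) fun φ => ?_⟩
  refine (hK.norm_omega_apply_le Y φ).trans ?_
  have h1 := mul_le_mul_of_nonneg_left (norm_perturb_apply_le hA hX φ) (norm_nonneg Y)
  linarith

/-- Trace bounds for `e^{-(A + X)}` that are uniform in `‖X‖ ≤ a`. -/
theorem summable_exp_neg_perturb (e : A.Eigenbasis ι) (f : (perturb A X.1).Eigenbasis κ) {β : ℝ}
    (hβ : 0 ≤ β) (hβa : β < 1 - a) (hs : Summable fun i => Real.exp (-(β * e.val i))) :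
    Summable (fun j => Real.exp (-(β / (1 - a) * f.val j))) ∧
    Summable (fun j => Real.exp (-f.val j)) ∧
    Summable (fun j => f.val j ^ 2 * Real.exp (-f.val j)) ∧
    ∑' j, f.val j ^ 2 * Real.exp (-f.val j) ≤
      2 / (1 - β / (1 - a)) ^ 2 * ∑' i, Real.exp (-(β * e.val i)) := by
  have hK := isPosSelfAdjoint_perturb hA ha ha1 hX
  have hform := (hA.katoRellich X.2.1 ha ha1 (norm_omega_apply_le_of_le hA hX)).2
  have h1a : 0 < 1 - a := by linarith
  have hq : 0 ≤ β / (1 - a) := div_nonneg hβ h1a.le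
  have hq1 : β / (1 - a) < 1 := (div_lt_one h1a).2 hβa
  -- The exponent $q=\beta/(1-a)$ cancels the loss $1-a$ in the form inequality, and $q<1$ leaves
  -- room to absorb the square of the eigenvalue.
  have hqe : β / (1 - a) * (1 - a) = β := div_mul_cancel₀ _ h1a.ne'
  obtain ⟨h1, h2⟩ := LinearPMap.Eigenbasis.tsum_exp_neg_le hA e f hq hform (by rwa [hqe])
  rw [hqe] at h2
  have hpos := f.val_pos hK
  have h3 : ∀ j, f.val j ^ 2 * Real.exp (-f.val j) ≤
      2 / (1 - β / (1 - a)) ^ 2 * Real.exp (-(β / (1 - a) * f.val j)) := fun j =>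
    sq_mul_exp_neg_le hq1 (hpos j).le
  have h4 : Summable (fun j => f.val j ^ 2 * Real.exp (-f.val j)) :=
    Summable.of_nonneg_of_le (fun j => by positivity) h3 (h1.mul_left _)
  refine ⟨h1, ?_, h4, ?_⟩
  · refine Summable.of_nonneg_of_le (fun j => (Real.exp_pos _).le) (fun j => ?_) h1
    rw [Real.exp_le_exp, neg_le_neg_iff]
    nlinarith [hpos j]
  · refine (h4.tsum_le_tsum h3 (h1.mul_left _)).trans ?_
    rw [tsum_mul_left]
    exact mul_le_mul_of_nonneg_left h2 (by positivity)

end Direction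

/-- The functional `Y ↦ -Z⁻¹ ∑ e^{-λ_i} ⟨e_i, Y e_i⟩` is bounded on the `ω`-directions. -/
theorem LinearPMap.Eigenbasis.exists_mean_functional {A : E →ₗ.[ℂ] E} (hA : A.IsPosSelfAdjoint)
    (f : A.Eigenbasis κ) (hs : Summable fun j => Real.exp (-f.val j))
    (hs2 : Summable fun j => f.val j ^ 2 * Real.exp (-f.val j)) :
    ∃ L : omegaDirections A →L[ℝ] ℝ, ∀ Y : omegaDirections A, L Y = -((partitionFunction A)⁻¹ *
      ∑' j, Real.exp (-f.val j) * (⟪f.basis j, Y.1 (f.vec j)⟫_ℂ).re) := by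
  have hs1 : Summable fun j => Real.exp (-f.val j) * f.val j := by
    refine Summable.of_nonneg_of_le (fun j => mul_nonneg (Real.exp_pos _).le (f.val_pos hA j).le)
      (fun j => ?_) (hs.add hs2)
    nlinarith [Real.exp_pos (-f.val j), mul_nonneg (Real.exp_pos (-f.val j)).le
      (sq_nonneg (f.val j - 1)), mul_nonneg (Real.exp_pos (-f.val j)).le
      (sq_nonneg (f.val j))]
  have hb : ∀ (Y : omegaDirections A) j,
      ‖Real.exp (-f.val j) * (⟪f.basis j, Y.1 (f.vec j)⟫_ℂ).re‖ ≤
        ‖Y‖ * (Real.exp (-f.val j) * f.val j) := by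
    intro Y j
    have h1 : |(⟪f.basis j, Y.1 (f.vec j)⟫_ℂ).re| ≤ ‖Y‖ * f.val j := by
      refine (Complex.abs_re_le_norm _).trans ((norm_inner_le_norm _ _).trans ?_)
      rw [f.basis.norm_eq_one, one_mul, ← f.norm_apply_vec hA]
      exact hA.norm_omega_apply_le Y _
    rw [norm_mul, Real.norm_of_nonneg (Real.exp_pos _).le, Real.norm_eq_abs, mul_left_comm]
    exact mul_le_mul_of_nonneg_left h1 (Real.exp_pos _).le
  have hsum : ∀ Y : omegaDirections A, Summable fun j =>
      Real.exp (-f.val j) * (⟪f.basis j, Y.1 (f.vec j)⟫_ℂ).re := fun Y =>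
    Summable.of_norm_bounded (hs1.mul_left ‖Y‖) (hb Y)
  let L : omegaDirections A →ₗ[ℝ] ℝ :=
    { toFun := fun Y => ∑' j, Real.exp (-f.val j) * (⟪f.basis j, Y.1 (f.vec j)⟫_ℂ).re
      map_add' := fun Y Y' => by
        rw [← (hsum Y).tsum_add (hsum Y')]
        refine tsum_congr fun j => ?_
        rw [Submodule.coe_add, LinearMap.add_apply, inner_add_right, Complex.add_re, mul_add]
      map_smul' := fun c Y => by
        rw [RingHom.id_apply, smul_eq_mul, ← tsum_mul_left]
        refine tsum_congr fun j => ?_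
        have h : (c • Y).1 (f.vec j) = (c : ℂ) • Y.1 (f.vec j) :=
          (Complex.coe_smul c (Y.1 (f.vec j))).symm
        rw [h, inner_smul_right, Complex.re_ofReal_mul]
        ring }
  have hL : ∀ Y, ‖L Y‖ ≤ (∑' j, Real.exp (-f.val j) * f.val j) * ‖Y‖ := by
    intro Y
    rw [mul_comm, ← tsum_mul_left]
    exact tsum_of_norm_bounded (hs1.mul_left ‖Y‖).hasSum (hb Y)
  refine ⟨-((partitionFunction A)⁻¹ • L.mkContinuous _ hL), fun Y => rfl⟩

/-- Second order estimate for the partition function near `A + X`. -/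
theorem abs_partitionFunction_sub_le [Nontrivial E] {A : E →ₗ.[ℂ] E} (hA : A.IsPosSelfAdjoint)
    (hc : IsCompactOperator (invOp A)) (e : A.Eigenbasis ι) {β a : ℝ} (hβ : 0 ≤ β)
    (hβa : β < 1 - a) (hs : Summable fun i => Real.exp (-(β * e.val i))) (ha : 0 < a)
    (ha1 : a < 1) {X : omegaDirections A} (f : (perturb A X.1).Eigenbasis κ)
    (Y : omegaDirections (perturb A X.1)) (hXY : ‖X‖ + (1 + a) * ‖Y‖ ≤ a) :
    0 < partitionFunction (perturb (perturb A X.1) Y.1) ∧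
    |partitionFunction (perturb (perturb A X.1) Y.1) - partitionFunction (perturb A X.1) +
        ∑' j, Real.exp (-f.val j) * (⟪f.basis j, Y.1 (f.vec j)⟫_ℂ).re| ≤
      ((1 - a)⁻¹ * (1 + a) * ‖Y‖) ^ 2 *
        (2 / (1 - β / (1 - a)) ^ 2 * ∑' i, Real.exp (-(β * e.val i)) +
          2 / (1 - β / (1 - a)) ^ 2 * ∑' i, Real.exp (-(β * e.val i))) := by
  have h1a : 0 < 1 - a := by linarith
  have hX : ‖X‖ ≤ a := le_trans (le_add_of_nonneg_right (by positivity)) hXY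
  have hK := isPosSelfAdjoint_perturb hA ha ha1 hX
  obtain ⟨-, hs0, hs2, hs2M⟩ := summable_exp_neg_perturb hA ha ha1 hX e f hβ hβa hs
  obtain ⟨Y', hY', hY'n⟩ := exists_omega_lift hA ha ha1 hX Y
  have hX' : ‖X + Y'‖ ≤ a := (norm_add_le _ _).trans (by linarith)
  have heq : perturb (perturb A X.1) Y.1 = perturb A (X + Y').1 := by
    rw [Submodule.coe_add, hY']
    exact perturb_perturb A X.1 Y.1
  have hK' : (perturb (perturb A X.1) Y.1).IsPosSelfAdjoint := by
    rw [heq]; exact isPosSelfAdjoint_perturb hA ha ha1 hX'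
  have hcK' : IsCompactOperator (invOp (perturb (perturb A X.1) Y.1)) := by
    rw [heq]; exact isCompactOperator_invOp_perturb hA ha ha1 hX' hc
  have hYφ : ∀ φ : A.domain, Y'.1 φ = Y.1 φ := fun φ => by rw [hY']; rfl
  have hbd : ∀ φ : A.domain, ‖A φ‖ ≤ (1 - a)⁻¹ * ‖perturb (perturb A X.1) Y.1 φ‖ := by
    intro φ
    have h1 : perturb A (X + Y').1 φ = perturb (perturb A X.1) Y.1 φ := by
      change A φ + (X.1 φ + Y'.1 φ) = A φ + X.1 φ + Y.1 φ
      rw [hYφ]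
      exact (add_assoc _ _ _).symm
    rw [← h1]
    exact norm_apply_le_perturb hA ha1 hX' φ
  obtain ⟨κ', ⟨g⟩⟩ := hK'.exists_eigenbasis hcK'
  -- The type of `g` depends on the operator, so the bounds are stated for a variable `B` and the
  -- equality is substituted.
  have key : ∀ B : E →ₗ.[ℂ] E, B = perturb A (X + Y').1 → ∀ g : B.Eigenbasis κ',
      Summable (fun j => Real.exp (-g.val j)) ∧
      Summable (fun j => g.val j ^ 2 * Real.exp (-g.val j)) ∧
      ∑' j, g.val j ^ 2 * Real.exp (-g.val j) ≤
        2 / (1 - β / (1 - a)) ^ 2 * ∑' i, Real.exp (-(β * e.val i)) := by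
    rintro _ rfl g
    exact (summable_exp_neg_perturb hA ha ha1 hX' e g hβ hβa hs).2
  obtain ⟨hg0, hg2, hg2M⟩ := key _ heq g
  -- The factor $1+a$ passes from the $\omega$-norm at $A+X$ to that at $A$, and $(1-a)^{-1}$ from
  -- $\|A\varphi\|$ to $\|(A+X+Y)\varphi\|$. Being at least one, the product also serves relative to
  -- $A+X$.
  have hQ1 : 1 ≤ (1 - a)⁻¹ * (1 + a) := by
    rw [inv_mul_eq_div, one_le_div h1a]
    linarith
  have hYK : ∀ φ, ‖Y.1 φ‖ ≤ (1 - a)⁻¹ * (1 + a) * ‖Y‖ * ‖perturb A X.1 φ‖ := by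
    intro φ
    exact (hK.norm_omega_apply_le Y φ).trans (mul_le_mul_of_nonneg_right
      (le_mul_of_one_le_left (norm_nonneg Y) hQ1) (norm_nonneg _))
  have hYK' : ∀ φ : A.domain, ‖Y.1 φ‖ ≤
      (1 - a)⁻¹ * (1 + a) * ‖Y‖ * ‖perturb (perturb A X.1) Y.1 φ‖ := by
    intro φ
    have h1 := hA.norm_omega_apply_le Y' φ
    rw [hYφ] at h1
    have h2 : ‖Y'‖ * ‖A φ‖ ≤
        ((1 + a) * ‖Y‖) * ((1 - a)⁻¹ * ‖perturb (perturb A X.1) Y.1 φ‖) :=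
      mul_le_mul hY'n (hbd φ) (norm_nonneg _) (by positivity)
    exact h1.trans (h2.trans (le_of_eq (by ring)))
  have hklein := LinearPMap.Eigenbasis.abs_tsum_exp_neg_sub_le hK hK' f g hYK hYK' hs0 hg0 hs2 hg2
  rw [← f.partitionFunction_eq hK hs0, ← g.partitionFunction_eq hK' hg0] at hklein
  exact ⟨g.partitionFunction_pos hK' hg0,
    hklein.trans (mul_le_mul_of_nonneg_left (add_le_add hs2M hg2M) (sq_nonneg _))⟩

/-- Second order estimate for the free energy near `A + X`, in the `ω`-norm at `A + X`. -/
theorem exists_freeEnergy_estimate [Nontrivial E] {A : E →ₗ.[ℂ] E} (hA : A.IsPosSelfAdjoint)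
    (hc : IsCompactOperator (invOp A)) (e : A.Eigenbasis ι) {β a : ℝ} (hβ : 0 ≤ β)
    (hβa : β < 1 - a) (hs : Summable fun i => Real.exp (-(β * e.val i))) (ha : 0 < a)
    (ha1 : a < 1) {X : omegaDirections A} (hX : ‖X‖ < a) :
    ∃ L : omegaDirections (perturb A X.1) →L[ℝ] ℝ,
      (∀ Y, HasMean (perturb A X.1) Y.1 (-(L Y : ℂ))) ∧
      ∃ D δ : ℝ, 0 < δ ∧ ∀ Y : omegaDirections (perturb A X.1), ‖Y‖ ≤ δ →
        |freeEnergy (perturb (perturb A X.1) Y.1) - freeEnergy (perturb A X.1) - L Y| ≤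
          D * ‖Y‖ ^ 2 := by
  have hK := isPosSelfAdjoint_perturb hA ha ha1 hX.le
  have hcK := isCompactOperator_invOp_perturb hA ha ha1 hX.le hc
  obtain ⟨κ, ⟨f⟩⟩ := hK.exists_eigenbasis hcK
  obtain ⟨-, hs0, hs2, -⟩ := summable_exp_neg_perturb hA ha ha1 hX.le e f hβ hβa hs
  obtain ⟨L, hL⟩ := f.exists_mean_functional hK hs0 hs2
  have hZ := f.partitionFunction_pos hK hs0
  refine ⟨L, fun Y => ?_, ?_⟩
  · have h := f.hasMean hK hcK hs0 hs2 Y.2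
    rw [← Complex.ofReal_neg, hL, neg_neg]
    exact h
  -- The radius $r$ ensures $\|X\|+(1+a)\|Y\|\le a$, so $X+Y$ stays in the ball where the trace
  -- bounds are uniform.
  refine exists_log_quadratic_bound hZ (r := (a - ‖X‖) / (1 + a))
    (D := ((1 - a)⁻¹ * (1 + a)) ^ 2 *
      (2 / (1 - β / (1 - a)) ^ 2 * ∑' i, Real.exp (-(β * e.val i)) +
        2 / (1 - β / (1 - a)) ^ 2 * ∑' i, Real.exp (-(β * e.val i)))) ?_
    (div_pos (by linarith) (by linarith)) fun Y hY => ?_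
  · have hM : 0 ≤ ∑' i, Real.exp (-(β * e.val i)) := tsum_nonneg fun i => (Real.exp_pos _).le
    positivity
  · rw [le_div_iff₀ (by linarith)] at hY
    have hest := abs_partitionFunction_sub_le hA hc e hβ hβa hs ha ha1 f Y (by linarith)
    have hlin : ∑' j, Real.exp (-f.val j) * (⟪f.basis j, Y.1 (f.vec j)⟫_ℂ).re =
        -(partitionFunction (perturb A X.1) * L Y) := by
      rw [hL, mul_neg, neg_neg, mul_inv_cancel_left₀ hZ.ne']
    rw [hlin, ← sub_eq_add_neg, mul_pow, mul_right_comm] at hest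
    exact hest

/-- The free energy is Fréchet differentiable at `A + X`, with derivative minus the mean, in the
`ω`-topology at `A + X`. -/
theorem exists_hasFDerivAt_freeEnergy_perturb [Nontrivial E] {A : E →ₗ.[ℂ] E}
    (hA : A.IsPosSelfAdjoint)
    (hc : IsCompactOperator (invOp A)) (e : A.Eigenbasis ι) {β a : ℝ} (hβ : 0 ≤ β)
    (hβa : β < 1 - a) (hs : Summable fun i => Real.exp (-(β * e.val i))) (ha : 0 < a)
    (ha1 : a < 1) {X : omegaDirections A} (hX : ‖X‖ < a) :
    ∃ L : omegaDirections (perturb A X.1) →L[ℝ] ℝ,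
      HasFDerivAt (fun Y : omegaDirections (perturb A X.1) =>
        freeEnergy (perturb (perturb A X.1) Y.1)) L 0 ∧
      ∀ Y : omegaDirections (perturb A X.1), HasMean (perturb A X.1) Y.1 (-(L Y : ℂ)) := by
  obtain ⟨L, hmean, D, δ, hδ, hest⟩ := exists_freeEnergy_estimate hA hc e hβ hβa hs ha ha1 hX
  refine ⟨L, hasFDerivAt_of_quadratic_bound (C := D) hδ fun Y hY => ?_, hmean⟩
  have hzero : perturb (perturb A X.1) (0 : omegaDirections (perturb A X.1)).1 =
      perturb A X.1 := by
    change (⟨A.domain, A.toFun + X.1 + 0⟩ : E →ₗ.[ℂ] E) = ⟨A.domain, A.toFun + X.1⟩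
    rw [add_zero]
  rw [zero_add, hzero]
  exact hest Y hY

/-- The free energy is Fréchet differentiable at `A + X`, with derivative minus the mean, in the
`ω`-topology at `A`. -/
theorem exists_hasFDerivAt_freeEnergy [Nontrivial E] {A : E →ₗ.[ℂ] E} (hA : A.IsPosSelfAdjoint)
    (hc : IsCompactOperator (invOp A)) (e : A.Eigenbasis ι) {β a : ℝ} (hβ : 0 ≤ β)
    (hβa : β < 1 - a) (hs : Summable fun i => Real.exp (-(β * e.val i))) (ha : 0 < a)
    (ha1 : a < 1) {X : omegaDirections A} (hX : ‖X‖ < a) :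
    ∃ L : omegaDirections A →L[ℝ] ℝ,
      HasFDerivAt (fun Y : omegaDirections A => freeEnergy (perturb A Y.1)) L X ∧
      ∀ Y : omegaDirections A, HasMean (perturb A X.1) Y.1 (-(L Y : ℂ)) := by
  obtain ⟨L, hmean, D, δ, hδ, hest⟩ := exists_freeEnergy_estimate hA hc e hβ hβa hs ha ha1 hX
  obtain ⟨J, hJ, hJn⟩ := exists_omega_inclusion hA ha ha1 hX.le
  have h1a : 0 < 1 - a := by linarith
  refine ⟨L.comp J, hasFDerivAt_of_quadratic_bound (C := |D| * ((1 - a)⁻¹) ^ 2)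
    (mul_pos h1a hδ) fun Y hY => ?_, fun Y => ?_⟩
  · have h1 : ‖J Y‖ ≤ δ := by
      refine (hJn Y).trans ?_
      rwa [inv_mul_le_iff₀ h1a]
    have h2 := hest (J Y) h1
    have h3 : perturb (perturb A X.1) (J Y).1 = perturb A (X + Y).1 :=
      (congrArg (perturb (perturb A X.1)) (hJ Y)).trans (perturb_perturb A X.1 Y.1)
    rw [h3] at h2
    refine h2.trans ?_
    rw [mul_assoc, ← mul_pow]
    exact mul_le_mul (le_abs_self D) (pow_le_pow_left₀ (norm_nonneg _) (hJn Y) 2)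
      (sq_nonneg _) (abs_nonneg D)
  · exact Eq.mp (congrArg (fun W => HasMean (perturb A X.1) W (-(L (J Y) : ℂ))) (hJ Y))
      (hmean (J Y))

end Perturbation

theorem mainTheorem2 {E : Type*} [NormedAddCommGroup E] [InnerProductSpace ℂ E] [CompleteSpace E]
    (H₀ : E →ₗ.[ℂ] E) (hsa : IsSelfAdjoint H₀) (hge : IsBoundedBelowBy H₀ 1)
    (β₀ : ℝ) (hβ₀ : 0 < β₀) (hβ₁ : β₀ < 1)
    (hρ₀ : IsDensityOperator (gibbsState H₀)) (hρβ : IsSchatten β₀ (gibbsState H₀))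
    (X : omegaDirections H₀) (hX : ‖X‖ < 1 - β₀) :
    (IsSelfAdjoint (perturb H₀ X) ∧ (∃ m : ℝ, 0 < m ∧ IsBoundedBelowBy (perturb H₀ X) m) ∧
      gibbsState (perturb H₀ X) ∈ stateManifold E ∧
      omegaDirections (perturb H₀ X) = omegaDirections H₀) ∧
    (∃ L : omegaDirections H₀ →L[ℝ] ℝ,
      HasFDerivAt (fun Y : omegaDirections H₀ => freeEnergy (perturb H₀ Y)) L X ∧
      ∀ Y : omegaDirections H₀, HasMean (perturb H₀ X) Y.1 (-(L Y : ℂ))) ∧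
    (∃ L : omegaDirections (perturb H₀ X) →L[ℝ] ℝ,
      HasFDerivAt (fun Y : omegaDirections (perturb H₀ X) =>
        freeEnergy (perturb (perturb H₀ X) Y)) L 0 ∧
      ∀ Y : omegaDirections (perturb H₀ X), HasMean (perturb H₀ X) Y.1 (-(L Y : ℂ))) := by
  have hA : H₀.IsPosSelfAdjoint := ⟨hsa, 1, one_pos, hge⟩
  have hE := nontrivial_of_isDensityOperator hρ₀
  have hZ₀ := partitionFunction_ne_zero hρ₀
  have hc := hA.isCompactOperator_inv hZ₀ hρβ.1
  obtain ⟨ι, ⟨e⟩⟩ := hA.exists_eigenbasis hc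
  have hs := e.summable_of_isSchatten hA hZ₀ hβ₀ hρβ
  -- Room above $\|X\|$ gives a neighbourhood of directions; room below $1-\beta_0$ keeps
  -- $\beta_0/(1-a)<1$.
  obtain ⟨a, hXa, haβ⟩ := exists_between hX
  have ha : 0 < a := (norm_nonneg X).trans_lt hXa
  have ha1 : a < 1 := by linarith
  have hβa : β₀ < 1 - a := by linarith
  have hK := isPosSelfAdjoint_perturb hA ha ha1 hXa.le
  have hcK := isCompactOperator_invOp_perturb hA ha ha1 hXa.le hc
  refine ⟨⟨hK.isSelfAdjoint, hK.exists_bound, ?_, omegaDirections_perturb hA ha ha1 hXa.le⟩,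
    exists_hasFDerivAt_freeEnergy hA hc e hβ₀.le hβa hs ha ha1 hXa,
    exists_hasFDerivAt_freeEnergy_perturb hA hc e hβ₀.le hβa hs ha ha1 hXa⟩
  obtain ⟨κ, ⟨f⟩⟩ := hK.exists_eigenbasis hcK
  obtain ⟨hsp, hs0, -, -⟩ := summable_exp_neg_perturb hA ha ha1 hXa.le e f hβ₀.le hβa hs
  exact f.gibbsState_mem_stateManifold hK hcK hs0 (div_pos hβ₀ (by linarith))
    ((div_lt_one (by linarith)).2 hβa) hsp
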